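/- Let $(X,Q),(X_1,Q_1),(X_2,Q_2),\dots$ be independent identically distributed random pairs with values in $\{0,1,2,\dots\}\times[0,1]$. For positive integers $n$ and $m$ let $G_{[n,m]}$ be the community affiliation graph defined by the truncated pairs $(\min\{X_i,n\},Q_i)$, $1\le i\le m$. That is, given these pairs, independently for each $i\in\{1,\dots,m\}$, a subset $\mathcal V_{n,i}\subset[n]=\{1,\dots,n\}$ of size $\min\{X_i,n\}$ is selected uniformly at random and every pair of distinct elements of $\mathcal V_{n,i}$ is linked, independently of all other pairs, with probability $Q_i$; $\mathcal E_{n,i}$ denotes the resulting set of edges. The graph $G_{[n,m]}$ has the vertex set $[n]$ and the edge set $\bigcup_{i=1}^m\mathcal E_{n,i}$. Put $h(x,q)=1-(1-q)^{(x-1)_+}$, where $(a)_+=\max\{a,0\}$ and $0^0=1$. Assume that $$\mathbf E\bigl(Q\,\mathbb I_{\{X\ge 2\}}\bigr)>0\qquad\text{and}\qquad \mathbf E\bigl(X\,h(X,Q)\ln(1+X)\bigr)<\infty,$$ and put $\kappa=\mathbf E\bigl(X\,h(X,Q)\bigr)$. Let $m=m(n)\to+\infty$ as $n\to+\infty$ and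 let $\lambda'_{n,m}=\ln n-\frac mn\kappa$. Then, as $n\to+\infty$, $$\mathbf P\{G_{[n,m]}\text{ is connected}\}\to\begin{cases}0,&\text{if }\lambda'_{n,m}\to+\infty,\\ 1,&\text{if }\lambda'_{n,m}\to-\infty.\end{cases}$$ -/

import Mathlib

open MeasureTheory ProbabilityTheory Filter Topology unitInterval

/-- The function `h(x, q) = 1 - (1 - q) ^ (x - 1)₊`, with `0 ^ 0 = 1`. The truncated subtraction of
natural numbers is the positive part `(x - 1)₊`. -/
noncomputable def hFun (x : ℕ) (q : ℝ) : ℝ := 1 - (1 - q) ^ (x - 1)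

/-- On a finite vertex set the measurable structure on simple graphs is discrete. -/
theorem simpleGraph_discrete (V : Type*) [Finite V] :
    DiscreteMeasurableSpace (SimpleGraph V) := by
  have h : ∀ G : SimpleGraph V, MeasurableSet ({G} : Set (SimpleGraph V)) := by
    intro G
    have := SimpleGraph.measurable_edgeSet (V := V) (measurableSet_singleton G.edgeSet)
    convert this using 1
    ext H
    simp
  have : MeasurableSingletonClass (SimpleGraph V) := ⟨h⟩
  infer_instance

/-- A family of finite measures on a countable space with measurable singletons depends measurably
on the parameter as soon as the masses of all points do. -/
theorem measurable_measure_of_singleton {α β : Type*} [MeasurableSpace α] [MeasurableSpace β]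
    [Countable β] [DiscreteMeasurableSpace β] (f : α → Measure β)
    (hf : ∀ b, Measurable fun a => f a {b}) : Measurable f := by
  refine Measure.measurable_of_measurable_coe f fun s _ => ?_
  have h : (fun a => f a s) = fun a => ∑' b : s, f a {(b : β)} := by
    funext a
    exact (Measure.tsum_indicator_apply_singleton (f a) s (.of_discrete)).symm.trans
      (tsum_subtype s fun b => f a {b}).symm
  rw [h]
  exact Measurable.tsum fun b => hf b

/-- The law of the Bernoulli random graph on the vertex subset `A` with edge density `q`, seen as a
graph on the whole vertex set `V`: every pair of distinct elements of `A` is an edge with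
probability `q`, independently of the other pairs, and there are no other edges. -/
noncomputable def bernoulliGraphOn {V : Type*} (A : Finset V) (q : I) :
    Measure (SimpleGraph V) :=
  (setBernoulli {e : Sym2 V | ¬ e.IsDiag ∧ ∀ v ∈ e, v ∈ A} q).map SimpleGraph.fromEdgeSet

/-- The law of one community (layer) with size `x` and density `q`: a vertex set `A ⊆ [n]` of size
`x` is selected uniformly at random, and then a Bernoulli graph with density `q` is put on `A`. -/
noncomputable def layerLaw (n : ℕ) (x : Fin (n + 1)) (q : I) : Measure (SimpleGraph (Fin n)) :=
  (uniformOn {A : Finset (Fin n) | A.card = x}).bind fun A => bernoulliGraphOn A q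

/-- The law of a Bernoulli graph on `A` depends measurably on the density. -/
theorem measurable_bernoulliGraphOn {V : Type*} [Finite V] (A : Finset V) :
    Measurable fun q : I => bernoulliGraphOn A q := by
  refine (Measure.measurable_map _ SimpleGraph.measurable_fromEdgeSet).comp ?_
  refine measurable_measure_of_singleton _ fun s => ?_
  by_cases hs : s ⊆ {e : Sym2 V | ¬ e.IsDiag ∧ ∀ v ∈ e, v ∈ A}
  · simp_rw [fun q : I => setBernoulli_singleton q hs (Set.toFinite _)]
    have h1 : Measurable fun q : I => toNNReal q :=
      measurable_subtype_coe.subtype_mk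
    have h2 : Measurable fun q : I => toNNReal (σ q) :=
      h1.comp unitInterval.continuous_symm.measurable
    fun_prop
  · simp_rw [fun q : I => setBernoulli_singleton_of_not_subset q hs]
    exact measurable_const

/-- The law of a layer depends measurably on its size and density. -/
theorem measurable_layerLaw (n : ℕ) :
    Measurable fun p : Fin (n + 1) × I => layerLaw n p.1 p.2 := by
  have := simpleGraph_discrete (Fin n)
  refine measurable_from_prod_countable_right fun x => ?_
  refine measurable_measure_of_singleton _ fun G => ?_
  have h (q : I) : layerLaw n x q {G} = ∑ A : Finset (Fin n),
      bernoulliGraphOn A q {G} * uniformOn {A : Finset (Fin n) | A.card = x} {A} := by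
    rw [layerLaw, Measure.bind_apply (.of_discrete) (Measurable.of_discrete).aemeasurable,
      lintegral_fintype]
  simp_rw [h]
  refine Finset.measurable_fun_sum _ fun A _ => Measurable.mul_const ?_ _
  exact (Measure.measurable_coe (.of_discrete)).comp (measurable_bernoulliGraphOn A)

instance isProbabilityMeasure_bernoulliGraphOn {V : Type*} (A : Finset V) (q : I) :
    IsProbabilityMeasure (bernoulliGraphOn A q) :=
  Measure.isProbabilityMeasure_map SimpleGraph.measurable_fromEdgeSet.aemeasurable

instance isProbabilityMeasure_layerLaw (n : ℕ) (x : Fin (n + 1)) (q : I) :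
    IsProbabilityMeasure (layerLaw n x q) := by
  have : IsProbabilityMeasure (uniformOn {A : Finset (Fin n) | A.card = x}) := by
    refine isProbabilityMeasure_uniformOn (Set.toFinite _) ?_
    obtain ⟨A, -, hA⟩ := Finset.exists_subset_card_eq
      (s := (Finset.univ : Finset (Fin n))) (n := x) (by simpa using Nat.lt_succ_iff.1 x.2)
    exact ⟨A, hA⟩
  exact isProbabilityMeasure_bind (Measurable.of_discrete).aemeasurable
    (ae_of_all _ fun A => inferInstance)

/-- Given the sizes and densities of the `m` communities, the communities are independent, the
`i`-th of them having the law of a layer with the `i`-th size and the `i`-th density. -/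
noncomputable def layersKernel (n m : ℕ) :
    Kernel (Fin m → Fin (n + 1) × I) (Fin m → SimpleGraph (Fin n)) where
  toFun p := Measure.pi fun i => layerLaw n (p i).1 (p i).2
  measurable' := by
    have := simpleGraph_discrete (Fin n)
    refine measurable_measure_of_singleton _ fun G => ?_
    simp_rw [Measure.pi_singleton]
    refine Finset.measurable_fun_prod _ fun i _ => ?_
    exact (Measure.measurable_coe (.of_discrete)).comp
      ((measurable_layerLaw n).comp (measurable_pi_apply i))

/-- The law of the community affiliation graph `G_{[n,m]}` on the vertex set `[n]` when `ν` is the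
joint law of the sizes and densities of its `m` communities: sizes and densities are sampled from
`ν`, given them the communities are sampled independently, and the edge set of the graph is the
union of the edge sets of the communities. -/
noncomputable def affiliationGraphLaw (n m : ℕ) (ν : Measure (Fin m → Fin (n + 1) × I)) :
    Measure (SimpleGraph (Fin n)) :=
  (ν.bind (layersKernel n m)).map fun H => ⨆ i, H i

/-- The truncated community size `min {x, n}`, an element of `{0, 1, …, n}`. -/
def truncSize (n x : ℕ) : Fin (n + 1) := ⟨min x n, by omega⟩

/-! Both halves rest on one observation: a union of layers has no edge across a cut iff no layer has
one. The layers are i.i.d., so the probability of no edge across `S` is `(1 - p) ^ m`, where `p` is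
the mean probability that one layer has an edge across `S` (`affiliationGraphLaw_real_eq_pow`). For
a single vertex `p` is about `κ / n`, hence about `exp λ'` isolated vertices are expected.

If `λ' → +∞`, the second moment method yields an isolated vertex. Two vertices are correlated only
through layers touching both, which costs a factor `exp (4 (m / n) U(1 / n))` with `U(s) = E (X h(X,
Q) min {1, s X})`.

If `λ' → -∞`, a union bound runs over cuts with `k ≤ n / 2` vertices on one side. Small cuts use `p
≥ (k / n) (κ - U(k / n))`. Cuts of linear size only need `p ≥ (k / n) E (Q 1{X ≥ 2})`, because `ln
(n / k)` is then bounded while `m / n` is at least of order `ln n`.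

The logarithmic moment enters through `tendsto_log_inv_mul_truncMoment`, `U(s) ln (1 / s) → 0`. It
makes both errors, of order `ln n · U(1 / n)` and `ln (n / k) · U(k / n)`, harmless. -/

/-- The simple graphs without edges between `S` and its complement. -/
def noEdgeAcross {V : Type*} (S : Finset V) : Set (SimpleGraph V) :=
  {G | ∀ u ∈ S, ∀ v ∉ S, ¬ G.Adj u v}

/-! ### Cuts in a Bernoulli graph and in a single layer -/

/-- A Bernoulli random set avoids a finite subset `F` of its support with probability
`(1 - q) ^ #F`. -/
theorem setBernoulli_real_disjoint {ι : Type*} (u : Set ι) (q : I) (F : Finset ι)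
    (hF : (F : Set ι) ⊆ u) :
    (setBernoulli u q).real {s | ∀ i ∈ F, i ∉ s} = (1 - (q : ℝ)) ^ F.card := by
  have h : ((fun p : ι → Prop => {i | p i}) ⁻¹' {s | ∀ i ∈ F, i ∉ s}) =
      Set.pi (F : Set ι) fun _ => {False} := by
    ext p
    simp [Set.mem_pi]
  rw [measureReal_def, setBernoulli_apply', h, Measure.infinitePi_pi _ (fun _ _ => .of_discrete)]
  have h2 : ∀ i ∈ F, ((toNNReal q • Measure.dirac (i ∈ u) + toNNReal (σ q) • Measure.dirac False :
      Measure Prop) {False}) = (toNNReal (σ q) : ENNReal) := by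
    intro i hi
    have : i ∈ u := hF hi
    rw [eq_true this, Measure.add_apply, Measure.smul_apply, Measure.smul_apply,
      Measure.dirac_apply' _ .of_discrete, Measure.dirac_apply' _ .of_discrete]
    simp only [Set.indicator, Set.mem_singleton_iff, Pi.one_apply, ENNReal.smul_def, smul_eq_mul]
    simp
  rw [Finset.prod_congr rfl h2]
  simp

/-- The probability that a Bernoulli graph on `A` has no edge between `S` and its complement. -/
theorem bernoulliGraphOn_real_noEdgeAcross {V : Type*} [Finite V] [DecidableEq V] (A S : Finset V)
    (q : I) : (bernoulliGraphOn A q).real (noEdgeAcross S) =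
      (1 - (q : ℝ)) ^ ((A ∩ S).card * (A \ S).card) := by
  have := simpleGraph_discrete V
  set u : Set (Sym2 V) := {e : Sym2 V | ¬ e.IsDiag ∧ ∀ v ∈ e, v ∈ A} with hu
  set F : Finset (Sym2 V) := ((A ∩ S) ×ˢ (A \ S)).image fun p => s(p.1, p.2) with hF
  have hFu : (F : Set (Sym2 V)) ⊆ u := by
    intro e he
    simp only [hF, Finset.coe_image, Set.mem_image, Finset.mem_coe, Finset.mem_product,
      Finset.mem_inter, Finset.mem_sdiff, Prod.exists] at he
    obtain ⟨a, b, ⟨⟨ha, haS⟩, hb, hbS⟩, rfl⟩ := he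
    refine ⟨?_, ?_⟩
    · rw [Sym2.mk_isDiag_iff]
      rintro rfl
      exact hbS haS
    · intro v hv
      rcases Sym2.mem_iff.1 hv with rfl | rfl <;> assumption
  have hcard : F.card = (A ∩ S).card * (A \ S).card := by
    rw [hF, Finset.card_image_of_injOn, Finset.card_product]
    rintro ⟨a, b⟩ hab ⟨c, d⟩ hcd h
    simp only [Finset.coe_product, Set.mem_prod, Finset.mem_coe, Finset.mem_inter,
      Finset.mem_sdiff] at hab hcd
    rcases Sym2.eq_iff.1 h with ⟨rfl, rfl⟩ | ⟨rfl, rfl⟩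
    · rfl
    · exact absurd hab.1.2 hcd.2.2
  -- The random edge set is almost surely contained in `u`; among subsets of `u`, the possible
  -- crossing edges are exactly the elements of `F`.
  rw [← hcard, ← setBernoulli_real_disjoint u q F hFu, bernoulliGraphOn,
    map_measureReal_apply SimpleGraph.measurable_fromEdgeSet (.of_discrete), measureReal_def,
    measureReal_def, setBernoulli_apply_eq_apply_subsets,
    setBernoulli_apply_eq_apply_subsets u q {s | ∀ i ∈ F, i ∉ s}]
  congr 2
  ext s
  simp only [Set.mem_ofPred_eq, Set.mem_preimage, noEdgeAcross, SimpleGraph.fromEdgeSet_adj]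
  refine and_congr_left fun hs => ⟨fun h e he hes => ?_, fun h a ha b hb hab => ?_⟩
  · simp only [hF, Finset.mem_image, Finset.mem_product, Finset.mem_inter, Finset.mem_sdiff,
      Prod.exists] at he
    obtain ⟨a, b, ⟨⟨ha, haS⟩, hb, hbS⟩, rfl⟩ := he
    exact h a haS b hbS ⟨hes, fun hab => hbS (hab ▸ haS)⟩
  · refine h s(a, b) ?_ hab.1
    have h2 := (hs hab.1).2
    simp only [hF, Finset.mem_image, Finset.mem_product, Finset.mem_inter, Finset.mem_sdiff,
      Prod.exists]
    exact ⟨a, b, ⟨⟨h2 a (by simp), ha⟩, h2 b (by simp), hb⟩, rfl⟩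

/-- The probability of an event under the law of a layer is the average of its conditional
probabilities given the vertex set of the layer. -/
theorem layerLaw_real (n : ℕ) (x : Fin (n + 1)) (q : I) (E : Set (SimpleGraph (Fin n))) :
    (layerLaw n x q).real E = ((n.choose x : ℝ))⁻¹ *
      ∑ A ∈ Finset.powersetCard x Finset.univ, (bernoulliGraphOn A q).real E := by
  have := simpleGraph_discrete (Fin n)
  classical
  have hset : {A : Finset (Fin n) | A.card = x} =
      ((Finset.powersetCard x Finset.univ : Finset (Finset (Fin n))) : Set (Finset (Fin n))) := by
    ext A
    simp [Finset.mem_powersetCard]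
  rw [layerLaw, measureReal_def, Measure.bind_apply (.of_discrete)
    (Measurable.of_discrete).aemeasurable, lintegral_fintype, ENNReal.toReal_sum
    (fun A _ => ENNReal.mul_ne_top (measure_ne_top _ _) ?_), Finset.mul_sum,
    ← Finset.sum_subset (Finset.subset_univ (Finset.powersetCard x Finset.univ))]
  · refine Finset.sum_congr rfl fun A hA => ?_
    rw [ENNReal.toReal_mul, ← measureReal_def, mul_comm, hset, ← Finset.coe_singleton,
      uniformOn_apply_finset, Finset.inter_singleton_of_mem hA]
    simp
  · intro A _ hA
    rw [hset, ← Finset.coe_singleton, uniformOn_apply_finset,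
      Finset.inter_singleton_of_notMem hA]
    simp
  · rw [hset, ← Finset.coe_singleton, uniformOn_apply_finset]
    refine ENNReal.div_ne_top (by simp) ?_
    rw [Finset.card_powersetCard, Finset.card_univ, Fintype.card_fin]
    have := Nat.choose_pos (Nat.lt_succ_iff.1 x.2)
    exact_mod_cast this.ne'

/-! ### Hypergeometric moments of `#(A ∩ S)` for a uniform `x`-subset `A` -/

theorem card_filter_powersetCard_mem {n : ℕ} (x : ℕ) (u : Fin n) :
    (n : ℝ) * ((Finset.powersetCard x Finset.univ).filter (u ∈ ·)).card = x * n.choose x := by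
  rcases Nat.eq_zero_or_pos x with rfl | hx
  · simp [Finset.filter_singleton]
  · have h := Finset.card_filter_powersetCard_subset {u} Finset.univ x (Finset.subset_univ _)
      (by rw [Finset.card_singleton]; exact hx)
    simp only [Finset.singleton_subset_iff, Finset.card_univ, Fintype.card_fin,
      Finset.card_singleton] at h
    rw [h]
    obtain ⟨y, rfl⟩ := Nat.exists_eq_add_of_lt hx
    obtain ⟨k, rfl⟩ := Nat.exists_eq_add_of_lt u.pos
    have := Nat.add_one_mul_choose_eq k y
    simp only [zero_add, Nat.add_sub_cancel]
    rw [mul_comm ((y + 1 : ℕ) : ℝ)]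
    exact_mod_cast this

/-- The absorption identity `(k + 1) C(k, y) = (y + 1) C(k + 1, y + 1)` applied twice. With
denominators cleared and real subtraction, the cases `x ≤ 1` need no exception in the statement. -/
theorem card_filter_powersetCard_mem_mem {n : ℕ} (x : ℕ) {u v : Fin n} (huv : u ≠ v) :
    (n : ℝ) * (n - 1) *
      ((Finset.powersetCard x Finset.univ).filter fun A => u ∈ A ∧ v ∈ A).card =
        x * (x - 1) * n.choose x := by
  have hcard : ({u, v} : Finset (Fin n)).card = 2 := Finset.card_pair huv
  rcases Nat.lt_or_ge x 2 with hx | hx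
  · have h0 : ((Finset.powersetCard x Finset.univ).filter fun A => u ∈ A ∧ v ∈ A) = ∅ := by
      refine Finset.filter_eq_empty_iff.2 fun A hA h => ?_
      have h1 : ({u, v} : Finset (Fin n)) ⊆ A := by
        simp [Finset.insert_subset_iff, h.1, h.2]
      have := Finset.card_le_card h1
      rw [hcard, (Finset.mem_powersetCard.1 hA).2] at this
      omega
    rw [h0]
    interval_cases x <;> simp
  · have h := Finset.card_filter_powersetCard_subset {u, v} Finset.univ x (Finset.subset_univ _)
      (by rwa [hcard])
    simp only [Finset.insert_subset_iff, Finset.singleton_subset_iff, Finset.card_univ,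
      Fintype.card_fin, hcard] at h
    rw [h]
    have hn : 2 ≤ n := by
      have := Finset.card_le_univ ({u, v} : Finset (Fin n))
      simpa [hcard] using this
    obtain ⟨y, rfl⟩ := Nat.exists_eq_add_of_le hx
    obtain ⟨k, rfl⟩ := Nat.exists_eq_add_of_le hn
    have h1 := Nat.add_one_mul_choose_eq k y
    have h2 := Nat.add_one_mul_choose_eq (k + 1) (y + 1)
    simp only [Nat.add_sub_cancel_left]
    rw [add_comm 2 k, add_comm 2 y]
    have h1' : ((k : ℝ) + 1) * k.choose y = (k + 1).choose (y + 1) * (y + 1) := by exact_mod_cast h1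
    have h2' : ((k : ℝ) + 1 + 1) * (k + 1).choose (y + 1) =
      (k + 1 + 1).choose (y + 1 + 1) * (y + 1 + 1) := by exact_mod_cast h2
    push_cast
    linear_combination ((k : ℝ) + 2) * h1' + ((y : ℝ) + 1) * h2'

theorem sum_card_inter_powersetCard {n : ℕ} (x : ℕ) (S : Finset (Fin n)) :
    (n : ℝ) * ∑ A ∈ Finset.powersetCard x Finset.univ, ((A ∩ S).card : ℝ) =
      S.card * x * n.choose x := by
  have h : ∀ A : Finset (Fin n), ((A ∩ S).card : ℝ) = ∑ u ∈ S, if u ∈ A then 1 else 0 := by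
    intro A
    rw [Finset.sum_boole, Finset.inter_comm, Finset.filter_mem_eq_inter]
  simp_rw [h]
  rw [Finset.sum_comm, Finset.mul_sum]
  simp_rw [Finset.sum_boole, card_filter_powersetCard_mem]
  rw [Finset.sum_const, nsmul_eq_mul, mul_assoc]

/-- Common source of the two quadratic moments below: `T = S.offDiag` counts ordered pairs inside
`S`, and `T = S ×ˢ Sᶜ` counts pairs across the cut. -/
theorem sum_card_pairs_powersetCard {n : ℕ} (x : ℕ) (T : Finset (Fin n × Fin n))
    (hT : ∀ p ∈ T, p.1 ≠ p.2) :
    (n : ℝ) * (n - 1) * ∑ A ∈ Finset.powersetCard x Finset.univ,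
      ((T.filter fun p => p.1 ∈ A ∧ p.2 ∈ A).card : ℝ) = T.card * (x * (x - 1) * n.choose x) := by
  have h : ∀ A : Finset (Fin n), ((T.filter fun p => p.1 ∈ A ∧ p.2 ∈ A).card : ℝ) =
      ∑ p ∈ T, if p.1 ∈ A ∧ p.2 ∈ A then 1 else 0 := by
    intro A
    rw [Finset.sum_boole]
  simp_rw [h]
  rw [Finset.sum_comm, Finset.mul_sum]
  simp_rw [Finset.sum_boole]
  rw [Finset.sum_congr rfl fun p hp => card_filter_powersetCard_mem_mem x (hT p hp),
    Finset.sum_const, nsmul_eq_mul]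

theorem sum_card_inter_mul_pred_powersetCard {n : ℕ} (x : ℕ) (S : Finset (Fin n)) :
    (n : ℝ) * (n - 1) * ∑ A ∈ Finset.powersetCard x Finset.univ,
      ((A ∩ S).card : ℝ) * ((A ∩ S).card - 1) =
        S.card * (S.card - 1) * (x * (x - 1) * n.choose x) := by
  have h := sum_card_pairs_powersetCard x S.offDiag fun p hp => (Finset.mem_offDiag.1 hp).2.2
  have hc : ∀ T : Finset (Fin n), ((T.offDiag.card : ℕ) : ℝ) = T.card * (T.card - 1) := by
    intro T
    rw [Finset.offDiag_card, Nat.cast_sub (Nat.le_mul_self _)]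
    push_cast
    ring
  rw [hc] at h
  rw [← h]
  congr 1
  refine Finset.sum_congr rfl fun A _ => ?_
  rw [← hc]
  congr 2
  ext p
  simp only [Finset.mem_offDiag, Finset.mem_inter, Finset.mem_filter]
  tauto

theorem sum_card_inter_mul_card_sdiff_powersetCard {n : ℕ} (x : ℕ) (S : Finset (Fin n)) :
    (n : ℝ) * (n - 1) * ∑ A ∈ Finset.powersetCard x Finset.univ,
      ((A ∩ S).card : ℝ) * (A \ S).card =
        S.card * (n - S.card) * (x * (x - 1) * n.choose x) := by
  have h := sum_card_pairs_powersetCard x (S ×ˢ Sᶜ) fun p hp => by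
    rw [Finset.mem_product, Finset.mem_compl] at hp
    exact fun h => hp.2 (h ▸ hp.1)
  rw [Finset.card_product, Nat.cast_mul, Finset.card_compl, Fintype.card_fin,
    Nat.cast_sub (by simpa using Finset.card_le_univ S)] at h
  rw [← h]
  congr 1
  refine Finset.sum_congr rfl fun A _ => ?_
  rw [← Nat.cast_mul, ← Finset.card_product]
  congr 2
  ext p
  simp only [Finset.mem_product, Finset.mem_inter, Finset.mem_sdiff, Finset.mem_filter,
    Finset.mem_compl]
  tauto

/-! ### Crossing probabilities of a single layer -/

theorem hFun_nonneg (x : ℕ) (q : I) : 0 ≤ hFun x q :=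
  sub_nonneg.2 (pow_le_one₀ (sub_nonneg.2 q.2.2) (by linarith [q.2.1]))

theorem hFun_mono {x y : ℕ} (hxy : x ≤ y) (q : I) : hFun x q ≤ hFun y q :=
  sub_le_sub_left (pow_le_pow_of_le_one (sub_nonneg.2 q.2.2) (by linarith [q.2.1]) (by omega)) _

theorem hFun_eq_zero {x : ℕ} (hx : x ≤ 1) (q : ℝ) : hFun x q = 0 := by
  simp [hFun, Nat.sub_eq_zero_of_le hx]

theorem le_hFun {x : ℕ} (hx : 2 ≤ x) (q : I) : (q : ℝ) ≤ hFun x q := by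
  simpa [hFun] using hFun_mono hx q

theorem bernoulliGraphOn_real_compl_noEdgeAcross {V : Type*} [Finite V] [DecidableEq V]
    (A S : Finset V) (q : I) : (bernoulliGraphOn A q).real (noEdgeAcross S)ᶜ =
      1 - (1 - (q : ℝ)) ^ ((A ∩ S).card * (A \ S).card) := by
  have := simpleGraph_discrete V
  rw [probReal_compl_eq_one_sub (.of_discrete), bernoulliGraphOn_real_noEdgeAcross]

/-- This is the origin of `h`: a member of a community of size `x` has `x - 1` potential neighbours
there. -/
theorem bernoulliGraphOn_real_compl_noEdgeAcross_singleton {V : Type*} [Finite V] [DecidableEq V]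
    (A : Finset V) (v : V) (q : I) : (bernoulliGraphOn A q).real (noEdgeAcross {v})ᶜ =
      if v ∈ A then hFun A.card q else 0 := by
  rw [bernoulliGraphOn_real_compl_noEdgeAcross]
  split_ifs with h
  · rw [Finset.inter_singleton_of_mem h, Finset.card_singleton, one_mul,
      Finset.sdiff_singleton_eq_erase, Finset.card_erase_of_mem h, hFun]
  · rw [Finset.inter_singleton_of_notMem h]
    simp

theorem choose_fin_pos {n : ℕ} (x : Fin (n + 1)) : (0 : ℝ) < n.choose x := by
  exact_mod_cast Nat.choose_pos (Nat.lt_succ_iff.1 x.2)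

/-- The probability that a given vertex is not isolated in a layer. -/
theorem layerLaw_real_compl_noEdgeAcross_singleton {n : ℕ} (x : Fin (n + 1)) (q : I) (v : Fin n) :
    (layerLaw n x q).real (noEdgeAcross {v})ᶜ = (x : ℕ) * hFun x q / n := by
  have hn : (0 : ℝ) < n := by exact_mod_cast v.pos
  have hN := choose_fin_pos x
  have h : ∀ A ∈ Finset.powersetCard (x : ℕ) (Finset.univ : Finset (Fin n)),
      (bernoulliGraphOn A q).real (noEdgeAcross {v})ᶜ =
        (if v ∈ A then 1 else 0) * hFun x q := by
    intro A hA
    rw [bernoulliGraphOn_real_compl_noEdgeAcross_singleton, (Finset.mem_powersetCard.1 hA).2]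
    split_ifs <;> simp
  rw [layerLaw_real, Finset.sum_congr rfl h, ← Finset.sum_mul, Finset.sum_boole]
  have h2 := card_filter_powersetCard_mem x v
  field_simp
  linear_combination hFun x q * h2

/-- A bound for the probability that neither of two given vertices is isolated in a layer. -/
theorem layerLaw_real_compl_inter_compl_le {n : ℕ} (x : Fin (n + 1)) (q : I) {u v : Fin n}
    (huv : u ≠ v) : (layerLaw n x q).real ((noEdgeAcross {u})ᶜ ∩ (noEdgeAcross {v})ᶜ) ≤
      (x : ℕ) * (x : ℕ) * hFun x q / (n * n) := by
  have hn : 2 ≤ n := by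
    have := Finset.card_le_univ ({u, v} : Finset (Fin n))
    rwa [Finset.card_pair huv, Fintype.card_fin] at this
  have hn' : (2 : ℝ) ≤ n := by exact_mod_cast hn
  have hN := choose_fin_pos x
  -- The joint event forces both vertices into `A`; its probability is then bounded by that of one
  -- of the two events alone.
  have h : ∀ A ∈ Finset.powersetCard (x : ℕ) (Finset.univ : Finset (Fin n)),
      (bernoulliGraphOn A q).real ((noEdgeAcross {u})ᶜ ∩ (noEdgeAcross {v})ᶜ) ≤
        (if u ∈ A ∧ v ∈ A then 1 else 0) * hFun x q := by
    intro A hA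
    have h1 := measureReal_mono (μ := bernoulliGraphOn A q)
      (Set.inter_subset_left (s := (noEdgeAcross {u})ᶜ) (t := (noEdgeAcross {v})ᶜ))
    have h2 := measureReal_mono (μ := bernoulliGraphOn A q)
      (Set.inter_subset_right (s := (noEdgeAcross {u})ᶜ) (t := (noEdgeAcross {v})ᶜ))
    rw [bernoulliGraphOn_real_compl_noEdgeAcross_singleton, (Finset.mem_powersetCard.1 hA).2]
      at h1 h2
    by_cases hu : u ∈ A <;> by_cases hv : v ∈ A <;> simp_all
  rw [layerLaw_real]
  have h3 := card_filter_powersetCard_mem_mem x huv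
  set c : ℝ := (((Finset.powersetCard (x : ℕ) Finset.univ).filter
    fun A => u ∈ A ∧ v ∈ A).card : ℝ) with hc
  have h4 : (n.choose x : ℝ)⁻¹ * c ≤ (x : ℕ) * (x : ℕ) / (n * n) := by
    have hxn : ((x : ℕ) : ℝ) ≤ n := by exact_mod_cast Nat.lt_succ_iff.1 x.2
    have h5 : (n.choose x : ℝ)⁻¹ * c = (x : ℕ) * ((x : ℕ) - 1) / (n * (n - 1)) := by
      have : (n : ℝ) - 1 ≠ 0 := by linarith
      field_simp
      linear_combination h3
    rw [h5, mul_div_mul_comm, mul_div_mul_comm]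
    refine mul_le_mul_of_nonneg_left ?_ (by positivity)
    rw [div_le_div_iff₀ (by linarith) (by linarith)]
    linarith
  calc _ ≤ (n.choose x : ℝ)⁻¹ * (c * hFun x q) := by
        refine mul_le_mul_of_nonneg_left ((Finset.sum_le_sum h).trans ?_) (by positivity)
        rw [← Finset.sum_mul, Finset.sum_boole]
    _ = (n.choose x : ℝ)⁻¹ * c * hFun x q := by ring
    _ ≤ (x : ℕ) * (x : ℕ) / (n * n) * hFun x q :=
        mul_le_mul_of_nonneg_right h4 (hFun_nonneg _ _)
    _ = _ := by ring

/-- If a community has vertices on both sides of a cut, then the conditional probability of having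
an edge across is at least `h`. -/
theorem hFun_le_one_sub_pow_mul {a b : ℕ} (ha : 1 ≤ a) (hb : 1 ≤ b) (q : I) :
    hFun (a + b) q ≤ 1 - (1 - (q : ℝ)) ^ (a * b) := by
  refine sub_le_sub_left (pow_le_pow_of_le_one (sub_nonneg.2 q.2.2) (by linarith [q.2.1]) ?_) _
  obtain ⟨c, rfl⟩ := Nat.exists_eq_add_of_le ha
  obtain ⟨d, rfl⟩ := Nat.exists_eq_add_of_le hb
  -- `a b = (a + b - 1) + (a - 1) (b - 1)`, so the cut contains at least as many pairs as the star
  -- of one vertex.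
  have : (1 + c) * (1 + d) = 1 + c + (1 + d) - 1 + c * d := by
    rw [show 1 + c + (1 + d) - 1 = 1 + c + d by omega]
    ring
  omega

theorem one_sub_pow_mul_nonneg (a : ℕ) (q : I) : 0 ≤ 1 - (1 - (q : ℝ)) ^ a :=
  sub_nonneg.2 (pow_le_one₀ (sub_nonneg.2 q.2.2) (by linarith [q.2.1]))

/-- A lower bound for the probability of an edge across a cut, effective for small cuts. -/
theorem le_layerLaw_real_compl_noEdgeAcross {n : ℕ} (hn : 2 ≤ n) (x : Fin (n + 1)) (q : I)
    (S : Finset (Fin n)) :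
    (S.card : ℝ) / n * ((x : ℕ) * hFun x q * (1 - S.card / n * (x : ℕ))) ≤
      (layerLaw n x q).real (noEdgeAcross S)ᶜ := by
  have hn' : (2 : ℝ) ≤ n := by exact_mod_cast hn
  have hN := choose_fin_pos x
  -- With `a = #(A ∩ S)`, the factor `a - a (a - 1) = a (2 - a)` is `1` at `a = 1` and nonpositive
  -- for `a ≥ 2`. Hence only layers meeting `S` in exactly one vertex have to be examined.
  have h : ∀ A ∈ Finset.powersetCard (x : ℕ) (Finset.univ : Finset (Fin n)),
      hFun x q * (((A ∩ S).card : ℝ) - ((A ∩ S).card : ℝ) * ((A ∩ S).card - 1)) ≤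
        (bernoulliGraphOn A q).real (noEdgeAcross S)ᶜ := by
    intro A hA
    have hx : (x : ℕ) = (A ∩ S).card + (A \ S).card := by
      rw [Finset.card_inter_add_card_sdiff, (Finset.mem_powersetCard.1 hA).2]
    rw [bernoulliGraphOn_real_compl_noEdgeAcross, hx]
    have hnn := hFun_nonneg ((A ∩ S).card + (A \ S).card) q
    have hnn2 := one_sub_pow_mul_nonneg ((A ∩ S).card * (A \ S).card) q
    generalize (A ∩ S).card = a at *
    generalize (A \ S).card = b at *
    rcases Nat.eq_zero_or_pos a with rfl | ha
    · simp
    · rcases Nat.lt_or_ge a 2 with ha2 | ha2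
      · obtain rfl : a = 1 := by omega
        rcases Nat.eq_zero_or_pos b with rfl | hb
        · simp [hFun]
        · have := hFun_le_one_sub_pow_mul (a := 1) le_rfl hb q
          simpa using this
      · have : (2 : ℝ) ≤ a := by exact_mod_cast ha2
        refine le_trans (mul_nonpos_of_nonneg_of_nonpos hnn ?_) hnn2
        nlinarith
  have h1 := sum_card_inter_powersetCard x S
  have h2 := sum_card_inter_mul_pred_powersetCard x S
  rw [layerLaw_real]
  refine le_trans ?_ (mul_le_mul_of_nonneg_left (Finset.sum_le_sum h) (by positivity))
  rw [← Finset.mul_sum, Finset.sum_sub_distrib]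
  set s1 := ∑ A ∈ Finset.powersetCard (x : ℕ) (Finset.univ : Finset (Fin n)),
    ((A ∩ S).card : ℝ)
  set s2 := ∑ A ∈ Finset.powersetCard (x : ℕ) (Finset.univ : Finset (Fin n)),
    ((A ∩ S).card : ℝ) * ((A ∩ S).card - 1)
  have hn1 : (0 : ℝ) < n - 1 := by linarith
  have e1 : (n.choose x : ℝ)⁻¹ * s1 = S.card * (x : ℕ) / n := by
    field_simp
    linear_combination h1
  have e2 : (n.choose x : ℝ)⁻¹ * s2 ≤ (S.card * (x : ℕ) / n) * (S.card / n * (x : ℕ)) := by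
    have e3 : (n.choose x : ℝ)⁻¹ * s2 =
        S.card * (x : ℕ) / n * ((S.card - 1) * (((x : ℕ) - 1) / (n - 1))) := by
      field_simp
      linear_combination h2
    rw [e3]
    have hxn : ((x : ℕ) : ℝ) ≤ n := by exact_mod_cast Nat.lt_succ_iff.1 x.2
    -- Since `x ≤ n`, lowering numerator and denominator by one lowers the ratio.
    have e4 : ((((x : ℕ) : ℝ) - 1) / (n - 1)) ≤ (x : ℕ) / n := by
      rw [div_le_div_iff₀ hn1 (by linarith)]
      linarith
    rcases Nat.eq_zero_or_pos S.card with h0 | h0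
    · simp [h0]
    refine mul_le_mul_of_nonneg_left ?_ (by positivity)
    · have h0' : (1 : ℝ) ≤ S.card := by exact_mod_cast h0
      calc ((S.card : ℝ) - 1) * ((((x : ℕ) : ℝ) - 1) / (n - 1))
          ≤ (S.card - 1) * ((x : ℕ) / n) := mul_le_mul_of_nonneg_left e4 (by linarith)
        _ ≤ S.card * ((x : ℕ) / n) := mul_le_mul_of_nonneg_right (by linarith) (by positivity)
        _ = _ := by ring
  calc _ = hFun x q * (S.card * (x : ℕ) / n -
        (S.card * (x : ℕ) / n) * (S.card / n * (x : ℕ))) := by ring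
    _ ≤ hFun x q * ((n.choose x : ℝ)⁻¹ * s1 - (n.choose x : ℝ)⁻¹ * s2) :=
        mul_le_mul_of_nonneg_left (by linarith) (hFun_nonneg _ _)
    _ = _ := by ring

/-- A lower bound for the probability of an edge across a cut, effective for large cuts. -/
theorem hFun_mul_le_layerLaw_real_compl_noEdgeAcross {n : ℕ} (hn : 2 ≤ n) (x : Fin (n + 1)) (q : I)
    (S : Finset (Fin n)) (hS : 2 * S.card ≤ n) :
    (S.card : ℝ) / n * hFun x q ≤ (layerLaw n x q).real (noEdgeAcross S)ᶜ := by
  rcases Nat.lt_or_ge x 2 with hx | hx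
  · rw [hFun_eq_zero (by omega), mul_zero]
    exact measureReal_nonneg
  have hx' : (2 : ℝ) ≤ (x : ℕ) := by exact_mod_cast hx
  have hn' : (2 : ℝ) ≤ n := by exact_mod_cast hn
  have hS' : (2 : ℝ) * S.card ≤ n := by exact_mod_cast hS
  have hN := choose_fin_pos x
  -- With `a + b = x`, AM-GM gives `4 a b / x ^ 2 ≤ 1`. So this quantity minorizes the indicator
  -- that `A` meets both sides, and its mean is explicit.
  have h : ∀ A ∈ Finset.powersetCard (x : ℕ) (Finset.univ : Finset (Fin n)),
      hFun x q * (4 / (x : ℕ) ^ 2 * (((A ∩ S).card : ℝ) * (A \ S).card)) ≤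
        (bernoulliGraphOn A q).real (noEdgeAcross S)ᶜ := by
    intro A hA
    have hx : (x : ℕ) = (A ∩ S).card + (A \ S).card := by
      rw [Finset.card_inter_add_card_sdiff, (Finset.mem_powersetCard.1 hA).2]
    rw [bernoulliGraphOn_real_compl_noEdgeAcross]
    rw [hx] at hx' ⊢
    generalize (A ∩ S).card = a at *
    generalize (A \ S).card = b at *
    rcases Nat.eq_zero_or_pos a with rfl | ha
    · simp
    rcases Nat.eq_zero_or_pos b with rfl | hb
    · simp
    refine le_trans (mul_le_of_le_one_right (hFun_nonneg _ _) ?_) (hFun_le_one_sub_pow_mul ha hb q)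
    rw [div_mul_eq_mul_div, div_le_one (by positivity)]
    push_cast
    nlinarith [sq_nonneg ((a : ℝ) - b)]
  have h2 := sum_card_inter_mul_card_sdiff_powersetCard x S
  rw [layerLaw_real]
  refine le_trans ?_ (mul_le_mul_of_nonneg_left (Finset.sum_le_sum h) (by positivity))
  rw [← Finset.mul_sum, ← Finset.mul_sum]
  set s2 := ∑ A ∈ Finset.powersetCard (x : ℕ) (Finset.univ : Finset (Fin n)),
    ((A ∩ S).card : ℝ) * (A \ S).card
  have hn1 : (0 : ℝ) < n - 1 := by linarith
  have e3 : (n.choose x : ℝ)⁻¹ * s2 =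
      S.card * (n - S.card) * ((x : ℕ) * ((x : ℕ) - 1)) / (n * (n - 1)) := by
    field_simp
    linear_combination h2
  calc (S.card : ℝ) / n * hFun x q = hFun x q * (S.card / n) := by ring
    _ ≤ hFun x q * (4 / (x : ℕ) ^ 2 *
        (S.card * (n - S.card) * ((x : ℕ) * ((x : ℕ) - 1)) / (n * (n - 1)))) := by
      refine mul_le_mul_of_nonneg_left ?_ (hFun_nonneg _ _)
      have e5 : 4 / ((x : ℕ) : ℝ) ^ 2 *
        (S.card * (n - S.card) * ((x : ℕ) * ((x : ℕ) - 1)) / (n * (n - 1))) =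
          S.card / n * (2 * (((x : ℕ) - 1) / (x : ℕ)) * (2 * ((n - S.card) / (n - 1)))) := by
        field_simp
        ring
      rw [e5]
      -- The two factors `2 (x - 1) / x` and `2 (n - #S) / (n - 1)` are at least `1`, by `x ≥ 2` and
      -- `2 #S ≤ n`.
      refine le_mul_of_one_le_right (by positivity) (one_le_mul_of_one_le_of_one_le ?_ ?_)
      · rw [← mul_div_assoc, one_le_div (by linarith)]
        linarith
      · rw [← mul_div_assoc, one_le_div (by linarith)]
        linarith
    _ = _ := by rw [← e3]; ring

/-! ### From one layer to the union of `m` layers -/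

theorem measurable_truncSize_prod (n : ℕ) :
    Measurable fun p : ℕ × I => (truncSize n p.1, p.2) :=
  ((Measurable.of_discrete (f := truncSize n)).comp measurable_fst).prodMk measurable_snd

theorem measurable_layerLaw_real (n : ℕ) (E : Set (SimpleGraph (Fin n))) :
    Measurable fun p : ℕ × I => (layerLaw n (truncSize n p.1) p.2).real E := by
  have := simpleGraph_discrete (Fin n)
  exact ((Measure.measurable_coe (.of_discrete)).comp
    ((measurable_layerLaw n).comp (measurable_truncSize_prod n))).ennreal_toReal

instance isProbabilityMeasure_affiliationGraphLaw (n m : ℕ) (ν : Measure (Fin m → Fin (n + 1) × I))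
    [IsProbabilityMeasure ν] : IsProbabilityMeasure (affiliationGraphLaw n m ν) := by
  have := simpleGraph_discrete (Fin n)
  have h : ∀ p, IsProbabilityMeasure (layersKernel n m p) := fun p =>
    inferInstanceAs (IsProbabilityMeasure (Measure.pi fun i => layerLaw n (p i).1 (p i).2))
  have := isProbabilityMeasure_bind (m := ν) (layersKernel n m).measurable.aemeasurable
    (ae_of_all _ h)
  exact Measure.isProbabilityMeasure_map (Measurable.of_discrete).aemeasurable

/-- If an event holds for a union of layers exactly when it holds for every layer, then its
probability in the affiliation graph with `m` independent identically distributed communities is the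
`m`-th power of its probability in a single layer. -/
theorem affiliationGraphLaw_real_eq_pow {Ω : Type*} [MeasurableSpace Ω] {μ : Measure Ω}
    [IsProbabilityMeasure μ] {X : Ω → ℕ} {Q : Ω → I} {Xs : ℕ → Ω → ℕ} {Qs : ℕ → Ω → I}
    (hindep : iIndepFun (fun i ω => (Xs i ω, Qs i ω)) μ)
    (hident : ∀ i, IdentDistrib (fun ω => (Xs i ω, Qs i ω)) (fun ω => (X ω, Q ω)) μ μ)
    (n m : ℕ) (E : Set (SimpleGraph (Fin n)))
    (hE : ∀ H : Fin m → SimpleGraph (Fin n), (⨆ i, H i) ∈ E ↔ ∀ i, H i ∈ E) :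
    (affiliationGraphLaw n m
      (μ.map fun ω (i : Fin m) => (truncSize n (Xs i ω), Qs i ω))).real E =
        (∫ ω, (layerLaw n (truncSize n (X ω)) (Q ω)).real E ∂μ) ^ m := by
  have := simpleGraph_discrete (Fin n)
  have hg := measurable_layerLaw_real n E
  have hae : AEMeasurable (fun ω (i : Fin m) => (truncSize n (Xs i ω), Qs i ω)) μ := by
    refine aemeasurable_pi_lambda _ fun i => ?_
    exact (measurable_truncSize_prod n).comp_aemeasurable (hident i).aemeasurable_fst
  have hset : ((fun H : Fin m → SimpleGraph (Fin n) => ⨆ i, H i) ⁻¹' E) =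
      Set.pi Set.univ fun _ => E := by
    ext H
    simp [hE, Set.mem_pi]
  have hker : ∀ p, layersKernel n m p (Set.pi Set.univ fun _ => E) =
      ∏ i, layerLaw n (p i).1 (p i).2 E := fun p => Measure.pi_pi _ _
  have hmeas : Measurable fun p => layersKernel n m p (Set.pi Set.univ fun _ => E) :=
    (Measure.measurable_coe (.of_discrete)).comp (layersKernel n m).measurable
  rw [affiliationGraphLaw, measureReal_def, Measure.map_apply (Measurable.of_discrete)
    (.of_discrete), hset, Measure.bind_apply (.of_discrete) (layersKernel n m).measurable.aemeasurable,
    lintegral_map' hmeas.aemeasurable hae, ← integral_toReal]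
  · simp_rw [hker, ENNReal.toReal_prod, ← measureReal_def]
    have hind : iIndepFun (fun (i : Fin m) ω => (Xs i ω, Qs i ω)) μ :=
      hindep.precomp Fin.val_injective
    obtain ⟨g, hgE⟩ : ∃ g : ℕ × I → ℝ, ∀ p, (layerLaw n (truncSize n p.1) p.2).real E = g p :=
      ⟨_, fun _ => rfl⟩
    simp only [hgE] at hg
    have hgE' : ∀ x q, (layerLaw n (truncSize n x) q).real E = g (x, q) := fun x q => hgE (x, q)
    simp only [hgE']
    -- Given the pairs the layers are independent, and the pairs are independent too, so the mean of
    -- the product factorizes.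
    rw [hind.integral_fun_prod_comp (f := fun _ => g)
      (fun i => (hident i).aemeasurable_fst) (fun i => hg.aestronglyMeasurable)]
    have h2 : ∀ i : Fin m, ∫ ω, g (Xs i ω, Qs i ω) ∂μ = ∫ ω, g (X ω, Q ω) ∂μ := fun i =>
      ((hident i).comp hg).integral_eq
    rw [Finset.prod_congr rfl fun i _ => h2 i]
    simp
  · exact hmeas.comp_aemeasurable hae
  · refine ae_of_all _ fun ω => ?_
    rw [hker]
    exact ENNReal.prod_lt_top fun i _ => measure_lt_top _ _

theorem iSup_mem_noEdgeAcross {V ι : Type*} (S : Finset V) (H : ι → SimpleGraph V) :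
    (⨆ i, H i) ∈ noEdgeAcross S ↔ ∀ i, H i ∈ noEdgeAcross S := by
  simp only [noEdgeAcross, Set.mem_ofPred_eq, SimpleGraph.iSup_adj, not_exists]
  exact ⟨fun h i u hu v hv => h u hu v hv i, fun h u hu v hv i => h i u hu v hv⟩

theorem iSup_mem_noEdgeAcross_inter {V ι : Type*} (S T : Finset V) (H : ι → SimpleGraph V) :
    (⨆ i, H i) ∈ noEdgeAcross S ∩ noEdgeAcross T ↔
      ∀ i, H i ∈ noEdgeAcross S ∩ noEdgeAcross T := by
  simp only [Set.mem_inter_iff, iSup_mem_noEdgeAcross, forall_and]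

/-! ### The logarithmic moment and the mean crossing probabilities -/

/-- Concavity of the logarithm: for `s x ≤ 1`, the point `1 + x` is the average of `1` and `1 + 1 /
s` with weights `1 - s x` and `s x`. This bound provides the dominating function for
`tendsto_log_inv_mul_truncMoment`. -/
theorem min_one_mul_mul_log_inv_le {s x : ℝ} (hs : 0 < s) (hx : 0 ≤ x) :
    min 1 (s * x) * Real.log s⁻¹ ≤ Real.log (1 + x) := by
  have hlog : 0 ≤ Real.log (1 + x) := Real.log_nonneg (by linarith)
  rcases le_total (Real.log s⁻¹) 0 with h | h
  · exact (mul_nonpos_of_nonneg_of_nonpos (by positivity) h).trans hlog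
  rcases le_total (s * x) 1 with h1 | h1
  · rw [min_eq_right h1]
    have h2 := strictConcaveOn_log_Ioi.concaveOn.2 (x := 1) (y := 1 + s⁻¹) (by simp)
      (by simp only [Set.mem_Ioi]; positivity) (sub_nonneg.2 h1) (by positivity : 0 ≤ s * x)
      (by ring)
    have h3 : (1 - s * x) • (1 : ℝ) + (s * x) • (1 + s⁻¹) = 1 + x := by
      simp only [smul_eq_mul]
      field_simp
      ring
    rw [h3, Real.log_one, smul_zero, zero_add, smul_eq_mul] at h2
    refine le_trans (mul_le_mul_of_nonneg_left ?_ (by positivity)) h2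
    exact Real.log_le_log (by positivity) (by linarith)
  · rw [min_eq_left h1, one_mul]
    refine Real.log_le_log (by positivity) ?_
    rw [inv_le_iff_one_le_mul₀ hs]
    nlinarith

section Moments

variable {Ω : Type*} [MeasurableSpace Ω] {μ : Measure Ω} {X : Ω → ℕ} {Q : Ω → I}

theorem measurable_hFun : Measurable fun p : ℕ × I => hFun p.1 p.2 := by
  refine measurable_from_prod_countable_right fun x => ?_
  simp only [hFun]
  fun_prop

theorem mul_hFun_nonneg (x : ℕ) (q : I) : 0 ≤ (x : ℝ) * hFun x q :=
  mul_nonneg (Nat.cast_nonneg _) (hFun_nonneg _ _)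

theorem measurable_mul_hFun : Measurable fun p : ℕ × I => (p.1 : ℝ) * hFun p.1 p.2 :=
  (Measurable.of_discrete.comp measurable_fst).mul measurable_hFun

theorem integrable_mul_hFun (hXQ : AEMeasurable (fun ω => (X ω, Q ω)) μ)
    (hmom : Integrable (fun ω => (X ω : ℝ) * hFun (X ω) (Q ω) * Real.log (1 + X ω)) μ) :
    Integrable (fun ω => (X ω : ℝ) * hFun (X ω) (Q ω)) μ := by
  refine (hmom.const_mul (Real.log 2)⁻¹).mono'
    (measurable_mul_hFun.comp_aemeasurable hXQ).aestronglyMeasurable (ae_of_all _ fun ω => ?_)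
  rw [Real.norm_of_nonneg (mul_hFun_nonneg _ _)]
  rcases Nat.eq_zero_or_pos (X ω) with h | h
  · simp [h]
  · have h1 : (1 : ℝ) ≤ X ω := by exact_mod_cast h
    have h2 : 0 < Real.log 2 := Real.log_pos (by norm_num)
    -- For `X ≥ 1` the logarithmic weight is at least `ln 2`; for `X = 0` the integrand vanishes.
    have h3 : Real.log 2 ≤ Real.log (1 + X ω) := Real.log_le_log (by norm_num) (by linarith)
    rw [inv_mul_eq_div, le_div_iff₀ h2]
    exact mul_le_mul_of_nonneg_left h3 (mul_hFun_nonneg _ _)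

/-- The truncated moment `E (X h(X, Q) min {1, s X})`. -/
noncomputable def truncMoment (μ : Measure Ω) (X : Ω → ℕ) (Q : Ω → I) (s : ℝ) : ℝ :=
  ∫ ω, (X ω : ℝ) * hFun (X ω) (Q ω) * min 1 (s * X ω) ∂μ

theorem measurable_mul_hFun_mul_min (s : ℝ) :
    Measurable fun p : ℕ × I => (p.1 : ℝ) * hFun p.1 p.2 * min 1 (s * (p.1 : ℝ)) :=
  measurable_mul_hFun.mul
    ((Measurable.of_discrete (f := fun x : ℕ => min 1 (s * (x : ℝ)))).comp measurable_fst)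

theorem integrable_mul_hFun_mul_min (hXQ : AEMeasurable (fun ω => (X ω, Q ω)) μ)
    (hint : Integrable (fun ω => (X ω : ℝ) * hFun (X ω) (Q ω)) μ) {s : ℝ} (hs : 0 ≤ s) :
    Integrable (fun ω => (X ω : ℝ) * hFun (X ω) (Q ω) * min 1 (s * X ω)) μ := by
  refine hint.mono' ((measurable_mul_hFun_mul_min s).comp_aemeasurable
    hXQ).aestronglyMeasurable (ae_of_all _ fun ω => ?_)
  rw [Real.norm_of_nonneg (mul_nonneg (mul_hFun_nonneg _ _) (by positivity))]
  exact mul_le_of_le_one_right (mul_hFun_nonneg _ _) (min_le_left _ _)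

/-- Dominated convergence with the integrand of the moment condition as majorant. Pointwise, the
integrand is at most `X ^ 2 h(X, Q) · s ln (1 / s)`, which tends to `0`. -/
theorem tendsto_log_inv_mul_truncMoment (hXQ : AEMeasurable (fun ω => (X ω, Q ω)) μ)
    (hmom : Integrable (fun ω => (X ω : ℝ) * hFun (X ω) (Q ω) * Real.log (1 + X ω)) μ) :
    Tendsto (fun s => Real.log s⁻¹ * truncMoment μ X Q s) (𝓝[>] 0) (𝓝 0) := by
  have hev : ∀ᶠ s : ℝ in 𝓝[>] 0, s ∈ Set.Ioo (0 : ℝ) 1 := Ioo_mem_nhdsGT one_pos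
  simp_rw [truncMoment, ← integral_const_mul]
  suffices h : Tendsto (fun s : ℝ => ∫ ω, Real.log s⁻¹ *
      ((X ω : ℝ) * hFun (X ω) (Q ω) * min 1 (s * X ω)) ∂μ) (𝓝[>] 0) (𝓝 (∫ _, 0 ∂μ)) by
    simpa using h
  refine tendsto_integral_filter_of_dominated_convergence _ (Eventually.of_forall fun s => ?_)
    ?_ hmom ?_
  · exact (((measurable_mul_hFun_mul_min s).comp_aemeasurable hXQ).const_mul
      _).aestronglyMeasurable
  · filter_upwards [hev] with s hs
    refine ae_of_all _ fun ω => ?_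
    have hl : 0 ≤ Real.log s⁻¹ := Real.log_nonneg ((one_le_inv₀ hs.1).2 hs.2.le)
    have hm : 0 ≤ min 1 (s * (X ω : ℝ)) := le_min zero_le_one (mul_nonneg hs.1.le (by positivity))
    rw [Real.norm_of_nonneg (mul_nonneg hl (mul_nonneg (mul_hFun_nonneg _ _) hm))]
    calc _ = (X ω : ℝ) * hFun (X ω) (Q ω) * (min 1 (s * X ω) * Real.log s⁻¹) := by ring
      _ ≤ _ := mul_le_mul_of_nonneg_left (min_one_mul_mul_log_inv_le hs.1 (by positivity))
        (mul_hFun_nonneg _ _)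
  · refine ae_of_all _ fun ω => ?_
    have h1 : Tendsto (fun s : ℝ => (X ω : ℝ) * hFun (X ω) (Q ω) * X ω * -(Real.log s * s))
        (𝓝[>] 0) (𝓝 0) := by
      have := (tendsto_log_mul_rpow_nhdsGT_zero zero_lt_one).neg.const_mul
        ((X ω : ℝ) * hFun (X ω) (Q ω) * X ω)
      simpa only [Real.rpow_one, neg_zero, mul_zero] using this
    refine tendsto_of_tendsto_of_tendsto_of_le_of_le' tendsto_const_nhds h1 ?_ ?_
    · filter_upwards [hev] with s hs
      have hl : 0 ≤ Real.log s⁻¹ := Real.log_nonneg ((one_le_inv₀ hs.1).2 hs.2.le)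
      have hm : 0 ≤ min 1 (s * (X ω : ℝ)) := le_min zero_le_one (mul_nonneg hs.1.le (by positivity))
      exact mul_nonneg hl (mul_nonneg (mul_hFun_nonneg _ _) hm)
    · filter_upwards [hev] with s hs
      have hl : 0 ≤ Real.log s⁻¹ := Real.log_nonneg ((one_le_inv₀ hs.1).2 hs.2.le)
      calc _ ≤ Real.log s⁻¹ * ((X ω : ℝ) * hFun (X ω) (Q ω) * (s * X ω)) :=
            mul_le_mul_of_nonneg_left (mul_le_mul_of_nonneg_left (min_le_right _ _)
              (mul_hFun_nonneg _ _)) hl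
        _ = _ := by rw [Real.log_inv]; ring

theorem integrable_indicator_density [IsFiniteMeasure μ]
    (hXQ : AEMeasurable (fun ω => (X ω, Q ω)) μ) :
    Integrable (fun ω => {ω | 2 ≤ X ω}.indicator (fun ω => (Q ω : ℝ)) ω) μ := by
  have hm : Measurable fun p : ℕ × I => {p : ℕ × I | 2 ≤ p.1}.indicator (fun p => (p.2 : ℝ)) p :=
    (measurable_subtype_coe.comp measurable_snd).indicator
      (measurableSet_le measurable_const measurable_fst)
  refine Integrable.of_bound (hm.comp_aemeasurable hXQ).aestronglyMeasurable 1
    (ae_of_all _ fun ω => ?_)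
  by_cases h : 2 ≤ X ω
  · simpa [Set.indicator, h, abs_of_nonneg (Q ω).2.1] using (Q ω).2.2
  · simp [Set.indicator, h]

theorem integral_mul_hFun_pos [IsFiniteMeasure μ] (hXQ : AEMeasurable (fun ω => (X ω, Q ω)) μ)
    (hint : Integrable (fun ω => (X ω : ℝ) * hFun (X ω) (Q ω)) μ)
    (hpos : 0 < ∫ ω, {ω | 2 ≤ X ω}.indicator (fun ω => (Q ω : ℝ)) ω ∂μ) :
    0 < ∫ ω, (X ω : ℝ) * hFun (X ω) (Q ω) ∂μ := by
  refine hpos.trans_le (integral_mono (integrable_indicator_density hXQ) hint fun ω => ?_)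
  by_cases h : 2 ≤ X ω
  · have h1 : (1 : ℝ) ≤ X ω := by exact_mod_cast (by omega : 1 ≤ X ω)
    simp only [Set.indicator, Set.mem_ofPred_eq, h, if_true]
    exact (le_hFun h _).trans (le_mul_of_one_le_left (hFun_nonneg _ _) h1)
  · simpa [Set.indicator, h] using mul_hFun_nonneg (X ω) (Q ω)

theorem coe_truncSize (n x : ℕ) : ((truncSize n x : Fin (n + 1)) : ℕ) = min x n := rfl

theorem integrable_layerLaw_real [IsFiniteMeasure μ] (hXQ : AEMeasurable (fun ω => (X ω, Q ω)) μ)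
    {n : ℕ} (E : Set (SimpleGraph (Fin n))) :
    Integrable (fun ω => (layerLaw n (truncSize n (X ω)) (Q ω)).real E) μ := by
  refine Integrable.of_bound
    ((measurable_layerLaw_real n E).comp_aemeasurable hXQ).aestronglyMeasurable 1
    (ae_of_all _ fun ω => ?_)
  rw [Real.norm_of_nonneg measureReal_nonneg]
  exact measureReal_le_one

/-- The mean probability that a given vertex is not isolated in a layer is at most `κ / n`. -/
theorem integral_layerLaw_compl_singleton_le [IsFiniteMeasure μ]
    (hXQ : AEMeasurable (fun ω => (X ω, Q ω)) μ)
    (hint : Integrable (fun ω => (X ω : ℝ) * hFun (X ω) (Q ω)) μ) {n : ℕ} (v : Fin n) :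
    ∫ ω, (layerLaw n (truncSize n (X ω)) (Q ω)).real (noEdgeAcross {v})ᶜ ∂μ ≤
      (∫ ω, (X ω : ℝ) * hFun (X ω) (Q ω) ∂μ) / n := by
  rw [← integral_div]
  refine integral_mono (integrable_layerLaw_real hXQ _) (hint.div_const _) fun ω => ?_
  simp only [layerLaw_real_compl_noEdgeAcross_singleton, coe_truncSize]
  refine div_le_div_of_nonneg_right (mul_le_mul ?_ (hFun_mono (min_le_left _ _) _)
    (hFun_nonneg _ _) (by positivity)) (by positivity)
  exact_mod_cast min_le_left _ _

theorem integral_layerLaw_compl_inter_compl_le [IsFiniteMeasure μ]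
    (hXQ : AEMeasurable (fun ω => (X ω, Q ω)) μ)
    (hint : Integrable (fun ω => (X ω : ℝ) * hFun (X ω) (Q ω)) μ) {n : ℕ} {u v : Fin n}
    (huv : u ≠ v) :
    ∫ ω, (layerLaw n (truncSize n (X ω)) (Q ω)).real
      ((noEdgeAcross {u})ᶜ ∩ (noEdgeAcross {v})ᶜ) ∂μ ≤ truncMoment μ X Q (n : ℝ)⁻¹ / n := by
  have hn : (0 : ℝ) < n := by exact_mod_cast u.pos
  rw [truncMoment, ← integral_div]
  refine integral_mono (integrable_layerLaw_real hXQ _)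
    ((integrable_mul_hFun_mul_min hXQ hint (by positivity)).div_const _) fun ω => ?_
  refine (layerLaw_real_compl_inter_compl_le _ _ huv).trans ?_
  simp only [coe_truncSize]
  -- One factor of the truncated size, divided by `n`, is exactly the weight in `truncMoment` at `s
  -- = 1 / n`.
  have h1 : min (1 : ℝ) ((n : ℝ)⁻¹ * X ω) = ((min (X ω) n : ℕ) : ℝ) / n := by
    rw [Nat.cast_min, ← min_div_div_right hn.le, div_self hn.ne', min_comm, inv_mul_eq_div]
  rw [h1]
  have h2 : ((min (X ω) n : ℕ) : ℝ) ≤ X ω := by exact_mod_cast min_le_left _ _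
  calc _ = ((min (X ω) n : ℕ) : ℝ) * hFun (min (X ω) n) (Q ω) *
        (((min (X ω) n : ℕ) : ℝ) / n) / n := by
        field_simp
    _ ≤ _ := div_le_div_of_nonneg_right (mul_le_mul_of_nonneg_right (mul_le_mul h2
        (hFun_mono (min_le_left _ _) _) (hFun_nonneg _ _) (by positivity)) (by positivity)) hn.le

theorem le_integral_layerLaw_compl_noEdgeAcross [IsFiniteMeasure μ]
    (hXQ : AEMeasurable (fun ω => (X ω, Q ω)) μ)
    (hint : Integrable (fun ω => (X ω : ℝ) * hFun (X ω) (Q ω)) μ) {n : ℕ} (hn : 2 ≤ n)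
    {S : Finset (Fin n)} (hS : S.Nonempty) :
    (S.card : ℝ) / n * ((∫ ω, (X ω : ℝ) * hFun (X ω) (Q ω) ∂μ) -
      truncMoment μ X Q (S.card / n)) ≤
      ∫ ω, (layerLaw n (truncSize n (X ω)) (Q ω)).real (noEdgeAcross S)ᶜ ∂μ := by
  have hn' : (0 : ℝ) < n := by exact_mod_cast (by omega : 0 < n)
  have hS' : (1 : ℝ) ≤ S.card := by exact_mod_cast hS.card_pos
  have hmin := integrable_mul_hFun_mul_min hXQ hint (s := S.card / n) (by positivity)
  rw [truncMoment, ← integral_sub hint hmin, ← integral_const_mul]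
  refine integral_mono ((hint.sub hmin).const_mul _) (integrable_layerLaw_real hXQ _) fun ω => ?_
  have h0 := le_layerLaw_real_compl_noEdgeAcross hn (truncSize n (X ω)) (Q ω) S
  simp only [coe_truncSize] at h0 ⊢
  -- If `#S · X ≥ n`, the lower bound is zero. Otherwise `X ≤ n` because `#S ≥ 1`, so the truncation
  -- at `n` is inactive.
  rcases le_total 1 ((S.card : ℝ) / n * X ω) with h | h
  · rw [min_eq_left h, mul_one, sub_self, mul_zero]
    exact measureReal_nonneg
  · have hX : X ω ≤ n := by
      rw [div_mul_eq_mul_div, div_le_one hn'] at h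
      have : (X ω : ℝ) ≤ n := le_trans (le_mul_of_one_le_left (by positivity) hS') h
      exact_mod_cast this
    rw [min_eq_left hX] at h0
    rw [min_eq_right h]
    refine le_trans (le_of_eq ?_) h0
    ring

theorem density_le_integral_layerLaw_compl_noEdgeAcross [IsFiniteMeasure μ]
    (hXQ : AEMeasurable (fun ω => (X ω, Q ω)) μ) {n : ℕ} (hn : 2 ≤ n) {S : Finset (Fin n)}
    (hS : 2 * S.card ≤ n) :
    (S.card : ℝ) / n * (∫ ω, {ω | 2 ≤ X ω}.indicator (fun ω => (Q ω : ℝ)) ω ∂μ) ≤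
      ∫ ω, (layerLaw n (truncSize n (X ω)) (Q ω)).real (noEdgeAcross S)ᶜ ∂μ := by
  rw [← integral_const_mul]
  refine integral_mono ((integrable_indicator_density hXQ).const_mul _)
    (integrable_layerLaw_real hXQ _) fun ω => ?_
  refine le_trans (mul_le_mul_of_nonneg_left ?_ (by positivity))
    (hFun_mul_le_layerLaw_real_compl_noEdgeAcross hn (truncSize n (X ω)) (Q ω) S hS)
  by_cases h : 2 ≤ X ω
  · simp only [Set.indicator, Set.mem_ofPred_eq, h, if_true, coe_truncSize]
    exact le_hFun (le_min h hn) _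
  · simpa [Set.indicator, h] using hFun_nonneg _ _

end Moments

/-! ### Connectivity: the union bound over cuts -/

theorem noEdgeAcross_compl {V : Type*} [Fintype V] [DecidableEq V] (S : Finset V) :
    noEdgeAcross Sᶜ = noEdgeAcross S := by
  ext G
  simp only [noEdgeAcross, Set.mem_ofPred_eq, Finset.mem_compl, not_not]
  exact ⟨fun h u hu v hv hG => h v hv u hu hG.symm, fun h u hu v hv hG => h v hv u hu hG.symm⟩

/-- A disconnected graph has a nonempty union of components with at most half of the vertices. -/
theorem exists_noEdgeAcross_of_not_connected {n : ℕ} (hn : 1 ≤ n) {G : SimpleGraph (Fin n)}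
    (hG : ¬ G.Connected) :
    ∃ S : Finset (Fin n), S.Nonempty ∧ 2 * S.card ≤ n ∧ G ∈ noEdgeAcross S := by
  classical
  have : Nonempty (Fin n) := ⟨⟨0, hn⟩⟩
  have h : ¬ G.Preconnected := fun h => hG ⟨h⟩
  simp only [SimpleGraph.Preconnected, not_forall] at h
  obtain ⟨u, v, huv⟩ := h
  set T : Finset (Fin n) := Finset.univ.filter fun w => G.Reachable u w with hT
  have hTG : G ∈ noEdgeAcross T := by
    intro a ha b hb hab
    simp only [hT, Finset.mem_filter, Finset.mem_univ, true_and] at ha hb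
    exact hb (ha.trans hab.reachable)
  have hcard := Finset.card_add_card_compl T
  rw [Fintype.card_fin] at hcard
  rcases le_total T.card Tᶜ.card with h | h
  · exact ⟨T, ⟨u, by simp [hT]⟩, by omega, hTG⟩
  · exact ⟨Tᶜ, ⟨v, by simpa [hT] using huv⟩, by omega, by rwa [noEdgeAcross_compl]⟩

/-- The union bound over all cuts. -/
theorem measureReal_not_connected_le {n : ℕ} (hn : 1 ≤ n) (P : Measure (SimpleGraph (Fin n)))
    [IsProbabilityMeasure P] {r : ℝ} (hr0 : 0 ≤ r) (hr1 : r < 1)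
    (h : ∀ S : Finset (Fin n), S.Nonempty → 2 * S.card ≤ n →
      n.choose S.card * P.real (noEdgeAcross S) ≤ r ^ S.card) :
    P.real {G | G.Connected}ᶜ ≤ r / (1 - r) := by
  classical
  set 𝒮 : Finset (Finset (Fin n)) := Finset.univ.filter fun S => S.Nonempty ∧ 2 * S.card ≤ n
  -- The value `0` at `k = 0` lets the sum run over all subsets, the empty one included; the
  -- binomial coefficients then cancel and leave a geometric series.
  set g : ℕ → ℝ := fun k => if k = 0 then 0 else r ^ k / n.choose k with hg
  have hg0 : ∀ k, 0 ≤ g k := fun k => by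
    simp only [hg]
    split_ifs <;> positivity
  have hsub : ({G : SimpleGraph (Fin n) | G.Connected}ᶜ : Set (SimpleGraph (Fin n))) ⊆
      ⋃ S ∈ 𝒮, noEdgeAcross S := by
    intro G hG
    obtain ⟨S, h1, h2, h3⟩ := exists_noEdgeAcross_of_not_connected hn hG
    exact Set.mem_biUnion (by simp [𝒮, h1, h2]) h3
  calc P.real {G | G.Connected}ᶜ ≤ P.real (⋃ S ∈ 𝒮, noEdgeAcross S) := measureReal_mono hsub (measure_ne_top _ _)
    _ ≤ ∑ S ∈ 𝒮, P.real (noEdgeAcross S) := measureReal_biUnion_finset_le _ _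
    _ ≤ ∑ S ∈ 𝒮, g S.card := by
        refine Finset.sum_le_sum fun S hS => ?_
        simp only [𝒮, Finset.mem_filter, Finset.mem_univ, true_and] at hS
        have h1 : (0 : ℝ) < n.choose S.card := by
          exact_mod_cast Nat.choose_pos (by omega)
        simp only [hg, if_neg hS.1.card_pos.ne']
        rw [le_div_iff₀' h1]
        exact h S hS.1 hS.2
    _ ≤ ∑ S ∈ (Finset.univ : Finset (Fin n)).powerset, g S.card := by
        rw [Finset.powerset_univ]
        exact Finset.sum_le_sum_of_subset_of_nonneg (Finset.subset_univ _) fun _ _ _ => hg0 _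
    _ = ∑ k ∈ Finset.range (n + 1), n.choose k • g k := by
        rw [Finset.sum_powerset_apply_card, Finset.card_univ, Fintype.card_fin]
    _ = ∑ k ∈ Finset.range n, r * r ^ k := by
        rw [Finset.sum_range_succ']
        simp only [hg, if_true, smul_zero, add_zero, Nat.succ_ne_zero, if_false, nsmul_eq_mul]
        refine Finset.sum_congr rfl fun k hk => ?_
        have h1 : (n.choose (k + 1) : ℝ) ≠ 0 := by
          exact_mod_cast (Nat.choose_pos (Finset.mem_range.1 hk)).ne'
        rw [mul_div_cancel₀ _ h1, pow_succ']
    _ ≤ r / (1 - r) := by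
        rw [← Finset.mul_sum, div_eq_mul_inv, ← tsum_geometric_of_lt_one hr0 hr1]
        exact mul_le_mul_of_nonneg_left ((summable_geometric_of_lt_one hr0 hr1).sum_le_tsum _
          fun _ _ => by positivity) hr0

/-- Combines `C(n, k) ≤ n ^ k / k!` with `k ^ k / k! ≤ e ^ k`. -/
theorem choose_le_exp {n k : ℕ} (hk : 1 ≤ k) (hn : 1 ≤ n) :
    (n.choose k : ℝ) ≤ Real.exp (k * (1 + Real.log ((k : ℝ) / n)⁻¹)) := by
  have hk' : (0 : ℝ) < k := by exact_mod_cast hk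
  have hn' : (0 : ℝ) < n := by exact_mod_cast hn
  have h1 := Real.pow_div_factorial_le_exp (k : ℝ) hk'.le k
  have h2 : Real.exp (k * Real.log ((k : ℝ) / n)⁻¹) = ((n : ℝ) / k) ^ k := by
    rw [mul_comm, Real.exp_mul, Real.exp_log (by positivity), inv_div, Real.rpow_natCast]
  rw [mul_add, mul_one, Real.exp_add, h2]
  calc (n.choose k : ℝ) ≤ (n : ℝ) ^ k / k.factorial := Nat.choose_le_pow_div k n
    _ = (k : ℝ) ^ k / k.factorial * ((n : ℝ) / k) ^ k := by
        rw [div_pow]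
        field_simp
    _ ≤ _ := mul_le_mul_of_nonneg_right h1 (by positivity)

theorem tendsto_probability_connected_one {Ω : Type*} [MeasurableSpace Ω] {μ : Measure Ω}
    [IsProbabilityMeasure μ] {X : Ω → ℕ} {Q : Ω → I} {Xs : ℕ → Ω → ℕ} {Qs : ℕ → Ω → I}
    (hindep : iIndepFun (fun i ω => (Xs i ω, Qs i ω)) μ)
    (hident : ∀ i, IdentDistrib (fun ω => (Xs i ω, Qs i ω)) (fun ω => (X ω, Q ω)) μ μ)
    (hpos : 0 < ∫ ω, {ω | 2 ≤ X ω}.indicator (fun ω => (Q ω : ℝ)) ω ∂μ)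
    (hmom : Integrable (fun ω => (X ω : ℝ) * hFun (X ω) (Q ω) * Real.log (1 + X ω)) μ)
    {m : ℕ → ℕ}
    (hlam : Tendsto (fun n : ℕ => Real.log n -
      (m n : ℝ) / n * ∫ ω, (X ω : ℝ) * hFun (X ω) (Q ω) ∂μ) atTop atBot) :
    Tendsto (fun n => (affiliationGraphLaw n (m n)
      (μ.map fun ω (i : Fin (m n)) => (truncSize n (Xs i ω), Qs i ω))).real
        {G | G.Connected}ᶜ) atTop (𝓝 0) := by
  have hXQ : AEMeasurable (fun ω => (X ω, Q ω)) μ := (hident 0).aemeasurable_snd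
  have hint := integrable_mul_hFun hXQ hmom
  have hκ := integral_mul_hFun_pos hXQ hint hpos
  have hp := fun (n : ℕ) (S : Finset (Fin n)) (hn : 2 ≤ n) (hS : S.Nonempty) =>
    le_integral_layerLaw_compl_noEdgeAcross hXQ hint hn hS
  have hp' := fun (n : ℕ) (S : Finset (Fin n)) (hn : 2 ≤ n) (hS : 2 * S.card ≤ n) =>
    density_le_integral_layerLaw_compl_noEdgeAcross hXQ hn hS
  have hU := tendsto_log_inv_mul_truncMoment hXQ hmom
  set κ := ∫ ω, (X ω : ℝ) * hFun (X ω) (Q ω) ∂μ with hκdef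
  set c := ∫ ω, {ω | 2 ≤ X ω}.indicator (fun ω => (Q ω : ℝ)) ω ∂μ with hcdef
  -- `ε` separates small cuts from large ones. The bound `ε ≤ 1 / e` gives `ln (1 / s) ≥ 1` for `s ≤
  -- ε`, so `U(s) ≤ κ / 2` follows as well.
  obtain ⟨ε, hε0, hε1, hεU⟩ : ∃ ε : ℝ, 0 < ε ∧ ε ≤ Real.exp (-1) ∧ ∀ s, 0 < s → s ≤ ε →
      Real.log s⁻¹ * truncMoment μ X Q s ≤ κ / 2 := by
    have := hU.eventually (ge_mem_nhds (half_pos hκ))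
    obtain ⟨δ, hδ, h⟩ := mem_nhdsGT_iff_exists_Ioc_subset.1 this
    exact ⟨min δ (Real.exp (-1)), lt_min hδ (Real.exp_pos _), min_le_right _ _,
      fun s hs hsε => h ⟨hs, hsε.trans (min_le_left _ _)⟩⟩
  set w : ℕ → ℝ := fun n => (m n : ℝ) / n * κ - Real.log n with hw
  have hw_lim : Tendsto w atTop atTop := by
    have := tendsto_neg_atBot_atTop.comp hlam
    refine this.congr fun n => ?_
    simp [hw]
  -- `θ` is the exponential gain per vertex of `S`: the first entry is what small cuts provide, the
  -- second what large cuts provide.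
  set θ : ℕ → ℝ := fun n => min (w n / 2 - 2) (Real.log n * (c / κ) - 1 - Real.log ε⁻¹) with hθ
  have hθ_lim : Tendsto θ atTop atTop := by
    refine Filter.tendsto_atTop.2 fun b => ?_
    have h1 := (hw_lim.atTop_div_const two_pos).eventually_ge_atTop (b + 2)
    have h2 := ((Real.tendsto_log_atTop.comp tendsto_natCast_atTop_atTop).atTop_mul_const
      (div_pos hpos hκ)).eventually_ge_atTop (b + 1 + Real.log ε⁻¹)
    filter_upwards [h1, h2] with n h1 h2
    simp only [Function.comp_apply] at h2
    exact le_min (by linarith) (by linarith)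
  have hr_lim : Tendsto (fun n => Real.exp (-θ n)) atTop (𝓝 0) :=
    Real.tendsto_exp_atBot.comp (tendsto_neg_atTop_atBot.comp hθ_lim)
  have hbound_lim : Tendsto (fun n => Real.exp (-θ n) / (1 - Real.exp (-θ n))) atTop (𝓝 0) := by
    have := hr_lim.div (hr_lim.const_sub 1) (by norm_num)
    rw [zero_div] at this
    exact this
  refine tendsto_of_tendsto_of_tendsto_of_le_of_le' tendsto_const_nhds hbound_lim
    (Eventually.of_forall fun n => measureReal_nonneg) ?_
  filter_upwards [hθ_lim.eventually_gt_atTop 0, hw_lim.eventually_ge_atTop 0, eventually_ge_atTop 2]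
    with n hθn hwn hn
  have hae : AEMeasurable (fun ω (i : Fin (m n)) => (truncSize n (Xs i ω), Qs i ω)) μ :=
    aemeasurable_pi_lambda _ fun i =>
      (measurable_truncSize_prod n).comp_aemeasurable (hident i).aemeasurable_fst
  have := Measure.isProbabilityMeasure_map hae
  refine measureReal_not_connected_le (by omega) _ (Real.exp_pos _).le
    (by simpa using hθn) fun S hS hS2 => ?_
  have hgraph := simpleGraph_discrete (Fin n)
  rw [affiliationGraphLaw_real_eq_pow hindep hident n (m n) _ (iSup_mem_noEdgeAcross S)]
  specialize hp n S hn hS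
  specialize hp' n S hn hS2
  have hcompl : ∫ ω, (layerLaw n (truncSize n (X ω)) (Q ω)).real (noEdgeAcross S) ∂μ =
      1 - ∫ ω, (layerLaw n (truncSize n (X ω)) (Q ω)).real (noEdgeAcross S)ᶜ ∂μ := by
    simp_rw [fun ω => probReal_compl_eq_one_sub (μ := layerLaw n (truncSize n (X ω)) (Q ω))
      (s := noEdgeAcross S) (.of_discrete)]
    rw [integral_sub (integrable_const _) (integrable_layerLaw_real hXQ _)]
    simp
  have hnn : 0 ≤ ∫ ω, (layerLaw n (truncSize n (X ω)) (Q ω)).real (noEdgeAcross S) ∂μ :=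
    integral_nonneg fun ω => measureReal_nonneg
  rw [hcompl] at hnn ⊢
  set p := ∫ ω, (layerLaw n (truncSize n (X ω)) (Q ω)).real (noEdgeAcross S)ᶜ ∂μ
  have hk : 1 ≤ S.card := hS.card_pos
  generalize S.card = k at *
  have hk' : (1 : ℝ) ≤ k := by exact_mod_cast hk
  have hn' : (2 : ℝ) ≤ n := by exact_mod_cast hn
  have hs0 : (0 : ℝ) < (k : ℝ) / n := by positivity
  have hpow : (1 - p) ^ m n ≤ Real.exp (-(m n * p)) := by
    rw [← mul_neg, Real.exp_nat_mul]
    exact pow_le_pow_left₀ hnn (Real.one_sub_le_exp_neg p) _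
  have ha : (m n : ℝ) / n * κ = Real.log n + w n := by
    simp [hw]
  have hlogn : Real.log n = Real.log ((k : ℝ) / n)⁻¹ + Real.log k := by
    rw [inv_div, Real.log_div (by positivity) (by positivity)]
    ring
  have hlogk : 0 ≤ Real.log k := Real.log_nonneg hk'
  have hl0 : 0 ≤ Real.log ((k : ℝ) / n)⁻¹ := by
    refine Real.log_nonneg ((one_le_inv₀ hs0).2 ?_)
    rw [div_le_one (by positivity)]
    exact_mod_cast (by omega : k ≤ n)
  -- Per vertex of `S`, the number of cuts costs `1 + ln (n / k)`, while the absence of crossing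
  -- edges gains `m p / k`.
  have hexp : 1 + Real.log ((k : ℝ) / n)⁻¹ + θ n ≤ (m n : ℝ) / n * (p * n / k) := by
    rcases le_total ((k : ℝ) / n) ε with hsε | hsε
    · have hUs := hεU _ hs0 hsε
      have hl1 : 1 ≤ Real.log ((k : ℝ) / n)⁻¹ := by
        rw [Real.log_inv, le_neg, Real.log_le_iff_le_exp hs0]
        exact hsε.trans hε1
      set l := Real.log ((k : ℝ) / n)⁻¹
      set U := truncMoment μ X Q ((k : ℝ) / n)
      have hpk : κ - U ≤ p * n / k := by
        rw [le_div_iff₀ (by positivity)]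
        rw [div_mul_eq_mul_div, div_le_iff₀ (by positivity)] at hp
        linarith
      have hu : U / κ * l ≤ 1 / 2 := by
        rw [div_mul_eq_mul_div, div_le_iff₀ hκ]
        linarith
      have hu2 : U / κ ≤ 1 / 2 := by
        by_contra! hcon
        nlinarith
      -- Writing `ln n = l + ln k`, the factor `1 - U / κ` costs at most `1 / 2` on `l` and half of
      -- `w`, and keeps the `ln k` term nonnegative. The result is at least `l - 1 / 2 + w / 2`,
      -- which exceeds `1 + l + θ`.
      have h1 : (m n : ℝ) / n * (κ - U) = (l + Real.log k + w n) * (1 - U / κ) := by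
        rw [← hlogn, ← ha]
        field_simp
      have h2 : (m n : ℝ) / n * (κ - U) ≤ (m n : ℝ) / n * (p * n / k) :=
        mul_le_mul_of_nonneg_left hpk (by positivity)
      have h3 : θ n ≤ w n / 2 - 2 := min_le_left _ _
      have h4 : 0 ≤ (Real.log k) * (1 - U / κ) := mul_nonneg hlogk (by linarith)
      have h5 : w n * (1 / 2) ≤ w n * (1 - U / κ) := mul_le_mul_of_nonneg_left (by linarith) hwn
      linarith
    · have hpk : c ≤ p * n / k := by
        rw [le_div_iff₀ (by positivity)]
        rw [div_mul_eq_mul_div, div_le_iff₀ (by positivity)] at hp'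
        linarith
      have h2 : (m n : ℝ) / n * c ≤ (m n : ℝ) / n * (p * n / k) :=
        mul_le_mul_of_nonneg_left hpk (by positivity)
      have h1 : (m n : ℝ) / n * c = (Real.log n + w n) * (c / κ) := by
        rw [← ha]
        field_simp
      have h3 : θ n ≤ Real.log n * (c / κ) - 1 - Real.log ε⁻¹ := min_le_right _ _
      have h4 : 0 ≤ w n * (c / κ) := mul_nonneg hwn (div_pos hpos hκ).le
      have h5 : Real.log ((k : ℝ) / n)⁻¹ ≤ Real.log ε⁻¹ :=
        Real.log_le_log (by positivity) (inv_anti₀ hε0 hsε)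
      linarith
  calc (n.choose k : ℝ) * (1 - p) ^ m n
      ≤ Real.exp (k * (1 + Real.log ((k : ℝ) / n)⁻¹)) * Real.exp (-(m n * p)) :=
        mul_le_mul (choose_le_exp hk (by omega)) hpow (by positivity) (Real.exp_pos _).le
    _ ≤ Real.exp (-θ n) ^ k := by
        rw [← Real.exp_add, ← Real.exp_nat_mul, Real.exp_le_exp]
        have h6 : (m n : ℝ) * p = k * ((m n : ℝ) / n * (p * n / k)) := by
          field_simp
        rw [h6]
        nlinarith

/-! ### Disconnectedness: isolated vertices and the second moment -/

/-- The second moment method for a finite family of events of equal probability. -/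
theorem measureReal_iInter_compl_le {α : Type*} [MeasurableSpace α] (P : Measure α)
    [IsProbabilityMeasure P] {n : ℕ} (hn : 1 ≤ n) (E : Fin n → Set α)
    (hE : ∀ i, MeasurableSet (E i)) {a b : ℝ} (ha : 0 < a) (hb : 0 ≤ b)
    (hPa : ∀ i, P.real (E i) = a) (hPb : ∀ i j, i ≠ j → P.real (E i ∩ E j) ≤ b) :
    P.real (⋂ i, (E i)ᶜ) ≤ (n * a)⁻¹ + (b / a ^ 2 - 1) := by
  classical
  have hn' : (0 : ℝ) < n := by exact_mod_cast hn
  set e : Fin n → α → ℝ := fun i => (E i).indicator 1 with he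
  have hei : ∀ i, Integrable (e i) P := fun i => (integrable_const 1).indicator (hE i)
  have heij : ∀ i j, (fun x => e i x * e j x) = (E i ∩ E j).indicator 1 := fun i j => by
    rw [Set.inter_indicator_one]
    rfl
  have hemul : ∀ i j, Integrable (fun x => e i x * e j x) P := fun i j => by
    rw [heij]
    exact (integrable_const 1).indicator ((hE i).inter (hE j))
  set N : α → ℝ := fun x => ∑ i, e i x with hN
  have hNint : Integrable N P := integrable_finsetSum _ fun i _ => hei i
  have hNsq : ∀ x, N x ^ 2 = ∑ i, ∑ j, e i x * e j x := fun x => by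
    rw [sq, hN, Finset.sum_mul_sum]
  have hNsqint : Integrable (fun x => N x ^ 2) P := by
    simp_rw [hNsq]
    exact integrable_finsetSum _ fun i _ => integrable_finsetSum _ fun j _ => hemul i j
  have hEN : ∫ x, N x ∂P = n * a := by
    rw [hN, integral_finsetSum _ fun i _ => hei i]
    simp_rw [he, integral_indicator_one (hE _), hPa]
    simp
  have hENsq : ∫ x, N x ^ 2 ∂P ≤ n * a + n ^ 2 * b := by
    simp_rw [hNsq]
    rw [integral_finsetSum _ fun i _ => integrable_finsetSum _ fun j _ => hemul i j]
    have hrow : ∀ i, ∫ x, ∑ j, e i x * e j x ∂P ≤ a + n * b := by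
      intro i
      rw [integral_finsetSum _ fun j _ => hemul i j]
      -- Adding `b ≥ 0` on the diagonal too is harmless and keeps the row sum uniform.
      have hterm : ∀ j, ∫ x, e i x * e j x ∂P ≤ (if j = i then a else 0) + b := by
        intro j
        rw [heij, integral_indicator_one ((hE i).inter (hE j))]
        by_cases hij : j = i
        · subst hij
          rw [Set.inter_self, hPa, if_pos rfl]
          linarith
        · rw [if_neg hij, zero_add]
          exact hPb i j (Ne.symm hij)
      refine (Finset.sum_le_sum fun j _ => hterm j).trans (le_of_eq ?_)
      rw [Finset.sum_add_distrib, Finset.sum_ite_eq']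
      simp
    refine (Finset.sum_le_sum fun i _ => hrow i).trans (le_of_eq ?_)
    rw [Finset.sum_const, Finset.card_univ, Fintype.card_fin, nsmul_eq_mul]
    ring
  have hF : MeasurableSet (⋂ i, (E i)ᶜ) := .iInter fun i => (hE i).compl
  -- Chebyshev's argument: `(N - n a) ^ 2` equals `(n a) ^ 2` where `N = 0` and is nonnegative
  -- elsewhere.
  have hmain : P.real (⋂ i, (E i)ᶜ) * (n * a) ^ 2 ≤ n * a + n ^ 2 * b - (n * a) ^ 2 := by
    calc P.real (⋂ i, (E i)ᶜ) * (n * a) ^ 2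
        = ∫ x, (⋂ i, (E i)ᶜ).indicator 1 x * (n * a) ^ 2 ∂P := by
          rw [integral_mul_const, integral_indicator_one hF]
      _ ≤ ∫ x, (N x ^ 2 - 2 * (n * a) * N x + (n * a) ^ 2) ∂P := by
          refine integral_mono (((integrable_const 1).indicator hF).mul_const _)
            ((hNsqint.sub (hNint.const_mul _)).add (integrable_const _)) fun x => ?_
          by_cases hx : x ∈ ⋂ i, (E i)ᶜ
          · have hNx : N x = 0 := Finset.sum_eq_zero fun i _ =>
              Set.indicator_of_notMem (Set.mem_iInter.1 hx i) _
            simp [hx, hNx]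
          · rw [Set.indicator_of_notMem hx, zero_mul]
            nlinarith [sq_nonneg (N x - n * a)]
      _ = ∫ x, N x ^ 2 ∂P - 2 * (n * a) * (n * a) + (n * a) ^ 2 := by
          have hsub : Integrable (fun x => N x ^ 2 - 2 * (n * a) * N x) P :=
            hNsqint.sub (hNint.const_mul _)
          rw [integral_add hsub (integrable_const _),
            integral_sub hNsqint (hNint.const_mul _), integral_const_mul, hEN]
          simp
      _ ≤ _ := by linarith
  have hna : 0 < n * a := mul_pos hn' ha
  calc P.real (⋂ i, (E i)ᶜ) ≤ (n * a + n ^ 2 * b - (n * a) ^ 2) / (n * a) ^ 2 := by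
        rwa [le_div_iff₀ (by positivity)]
    _ = _ := by
        field_simp
        ring

theorem connected_subset_iInter_compl {n : ℕ} (hn : 2 ≤ n) :
    {G : SimpleGraph (Fin n) | G.Connected} ⊆ ⋂ v, (noEdgeAcross {v})ᶜ := by
  intro G hG
  refine Set.mem_iInter.2 fun v hv => ?_
  have : Nontrivial (Fin n) := Fin.nontrivial_iff_two_le.2 hn
  obtain ⟨w, hw⟩ := exists_ne v
  obtain ⟨p⟩ := hG.preconnected v w
  cases p with
  | nil => exact hw rfl
  | cons h _ => exact hv v (by simp) _ (by simpa using h.ne') h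

/-- From `ln (1 - p) ≥ -p / (1 - p)` and `p / (1 - p) ≤ p + 2 p ^ 2` for `p ≤ 1 / 2`. The quadratic
error remains bounded after multiplication by `m` when `t = κ / n` and `m κ / n ≤ ln n`. -/
theorem exp_neg_le_one_sub_pow {p t : ℝ} (hp : 0 ≤ p) (hpt : p ≤ t) (ht : t ≤ 1 / 2) (m : ℕ) :
    Real.exp (-(m * (t + 2 * t ^ 2))) ≤ (1 - p) ^ m := by
  have h1 : 0 < 1 - p := by linarith
  rw [← mul_neg, Real.exp_nat_mul]
  refine pow_le_pow_left₀ (Real.exp_pos _).le ?_ _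
  rw [← Real.le_log_iff_exp_le h1]
  refine le_trans ?_ (Real.one_sub_inv_le_log_of_pos h1)
  have h2 : 1 - (1 - p)⁻¹ = -(p / (1 - p)) := by
    field_simp
    ring
  rw [h2, neg_le_neg_iff, div_le_iff₀ h1]
  nlinarith [mul_nonneg hp hp, mul_nonneg (mul_nonneg hp hp) (by linarith : 0 ≤ 1 - 2 * p)]

theorem tendsto_probability_connected_zero {Ω : Type*} [MeasurableSpace Ω] {μ : Measure Ω}
    [IsProbabilityMeasure μ] {X : Ω → ℕ} {Q : Ω → I} {Xs : ℕ → Ω → ℕ} {Qs : ℕ → Ω → I}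
    (hindep : iIndepFun (fun i ω => (Xs i ω, Qs i ω)) μ)
    (hident : ∀ i, IdentDistrib (fun ω => (Xs i ω, Qs i ω)) (fun ω => (X ω, Q ω)) μ μ)
    (hpos : 0 < ∫ ω, {ω | 2 ≤ X ω}.indicator (fun ω => (Q ω : ℝ)) ω ∂μ)
    (hmom : Integrable (fun ω => (X ω : ℝ) * hFun (X ω) (Q ω) * Real.log (1 + X ω)) μ)
    {m : ℕ → ℕ}
    (hlam : Tendsto (fun n : ℕ => Real.log n -
      (m n : ℝ) / n * ∫ ω, (X ω : ℝ) * hFun (X ω) (Q ω) ∂μ) atTop atTop) :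
    Tendsto (fun n => (affiliationGraphLaw n (m n)
      (μ.map fun ω (i : Fin (m n)) => (truncSize n (Xs i ω), Qs i ω))).real
        {G | G.Connected}) atTop (𝓝 0) := by
  have hXQ : AEMeasurable (fun ω => (X ω, Q ω)) μ := (hident 0).aemeasurable_snd
  have hint := integrable_mul_hFun hXQ hmom
  have hκ := integral_mul_hFun_pos hXQ hint hpos
  have hp := fun (n : ℕ) (v : Fin n) => integral_layerLaw_compl_singleton_le hXQ hint v
  have hδ := fun (n : ℕ) (u v : Fin n) (huv : u ≠ v) =>
    integral_layerLaw_compl_inter_compl_le hXQ hint huv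
  have hU := tendsto_log_inv_mul_truncMoment hXQ hmom
  set κ := ∫ ω, (X ω : ℝ) * hFun (X ω) (Q ω) ∂μ with hκdef
  set lam : ℕ → ℝ := fun n => Real.log n - (m n : ℝ) / n * κ with hlamdef
  set R : ℕ → ℝ := fun n => Real.log ((n : ℝ)⁻¹)⁻¹ * truncMoment μ X Q (n : ℝ)⁻¹ with hR
  have hR_lim : Tendsto R atTop (𝓝 0) := by
    refine hU.comp (tendsto_nhdsWithin_iff.2 ⟨tendsto_inv_atTop_nhds_zero_nat, ?_⟩)
    filter_upwards [eventually_gt_atTop 0] with n hn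
    have : (0 : ℝ) < n := by exact_mod_cast hn
    exact inv_pos.2 this
  -- The first term bounds the reciprocal of the expected number of isolated vertices, the second
  -- the relative excess of pair probabilities over independence.
  have hbound_lim : Tendsto (fun n => (Real.exp (lam n - 2 * κ))⁻¹ +
      (Real.exp (4 / κ * R n) - 1)) atTop (𝓝 0) := by
    have h1 : Tendsto (fun n => (Real.exp (lam n - 2 * κ))⁻¹) atTop (𝓝 0) :=
      tendsto_inv_atTop_zero.comp (Real.tendsto_exp_atTop.comp
        (tendsto_atTop_add_const_right _ _ hlam))
    have h2 : Tendsto (fun n => Real.exp (4 / κ * R n)) atTop (𝓝 (Real.exp (4 / κ * 0))) :=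
      (Real.continuous_exp.tendsto _).comp (hR_lim.const_mul _)
    have h3 := h1.add (h2.sub_const 1)
    simpa using h3
  refine tendsto_of_tendsto_of_tendsto_of_le_of_le' tendsto_const_nhds hbound_lim
    (Eventually.of_forall fun n => measureReal_nonneg) ?_
  filter_upwards [hlam.eventually_ge_atTop 0, eventually_ge_atTop 2,
    tendsto_natCast_atTop_atTop.eventually_ge_atTop (2 * κ)] with n hlamn hn hnκ
  have hn' : (2 : ℝ) ≤ n := by exact_mod_cast hn
  have hae : AEMeasurable (fun ω (i : Fin (m n)) => (truncSize n (Xs i ω), Qs i ω)) μ :=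
    aemeasurable_pi_lambda _ fun i =>
      (measurable_truncSize_prod n).comp_aemeasurable (hident i).aemeasurable_fst
  have := Measure.isProbabilityMeasure_map hae
  have hgraph := simpleGraph_discrete (Fin n)
  set P := affiliationGraphLaw n (m n)
    (μ.map fun ω (i : Fin (m n)) => (truncSize n (Xs i ω), Qs i ω)) with hP
  obtain ⟨p, hpv⟩ : ∃ p, ∀ v : Fin n,
      ∫ ω, (layerLaw n (truncSize n (X ω)) (Q ω)).real (noEdgeAcross {v})ᶜ ∂μ = p := by
    simp_rw [layerLaw_real_compl_noEdgeAcross_singleton]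
    exact ⟨_, fun _ => rfl⟩
  have hp0 : 0 ≤ p := by
    rw [← hpv ⟨0, by omega⟩]
    exact integral_nonneg fun ω => measureReal_nonneg
  have hpκ : p ≤ κ / n := by
    rw [← hpv ⟨0, by omega⟩]
    exact hp n _
  have hκn : κ / n ≤ 1 / 2 := by
    rw [div_le_div_iff₀ (by linarith) two_pos]
    linarith
  set U := truncMoment μ X Q (n : ℝ)⁻¹ with hUdef
  have hU0 : 0 ≤ U := integral_nonneg fun ω =>
    mul_nonneg (mul_hFun_nonneg _ _) (le_min zero_le_one (by positivity))
  have hPa : ∀ v : Fin n, P.real (noEdgeAcross {v}) = (1 - p) ^ m n := by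
    intro v
    rw [hP, affiliationGraphLaw_real_eq_pow hindep hident n (m n) _ (iSup_mem_noEdgeAcross _),
      ← hpv v]
    simp_rw [fun ω => probReal_compl_eq_one_sub (μ := layerLaw n (truncSize n (X ω)) (Q ω))
      (s := noEdgeAcross {v}) (.of_discrete)]
    rw [integral_sub (integrable_const _) (integrable_layerLaw_real hXQ _)]
    simp
  have ha0 : 0 < (1 - p) ^ m n := pow_pos (by linarith) _
  have hPb : ∀ u v : Fin n, u ≠ v → P.real (noEdgeAcross {u} ∩ noEdgeAcross {v}) ≤
      ((1 - p) ^ m n) ^ 2 * Real.exp (4 * (m n / n * U)) := by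
    intro u v huv
    -- Inclusion-exclusion for the two events of being non-isolated in the layer.
    have hlayer : ∀ ω, (layerLaw n (truncSize n (X ω)) (Q ω)).real
        (noEdgeAcross {u} ∩ noEdgeAcross {v}) =
          1 - (layerLaw n (truncSize n (X ω)) (Q ω)).real (noEdgeAcross {u})ᶜ -
            (layerLaw n (truncSize n (X ω)) (Q ω)).real (noEdgeAcross {v})ᶜ +
            (layerLaw n (truncSize n (X ω)) (Q ω)).real
              ((noEdgeAcross {u})ᶜ ∩ (noEdgeAcross {v})ᶜ) := by
      intro ω
      have h1 := measureReal_union_add_inter (μ := layerLaw n (truncSize n (X ω)) (Q ω))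
        (s := (noEdgeAcross {u})ᶜ) (t := (noEdgeAcross {v})ᶜ) (.of_discrete)
      rw [← Set.compl_inter, probReal_compl_eq_one_sub (.of_discrete)] at h1
      linarith
    have hδuv := hδ n u v huv
    have hnn : 0 ≤ ∫ ω, (layerLaw n (truncSize n (X ω)) (Q ω)).real
        (noEdgeAcross {u} ∩ noEdgeAcross {v}) ∂μ := integral_nonneg fun ω => measureReal_nonneg
    rw [hP, affiliationGraphLaw_real_eq_pow hindep hident n (m n) _
      (iSup_mem_noEdgeAcross_inter _ _)]
    have hval : ∫ ω, (layerLaw n (truncSize n (X ω)) (Q ω)).real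
        (noEdgeAcross {u} ∩ noEdgeAcross {v}) ∂μ ≤ 1 - p - p + U / n := by
      simp_rw [hlayer]
      have hi : ∀ E : Set (SimpleGraph (Fin n)),
          Integrable (fun ω => (layerLaw n (truncSize n (X ω)) (Q ω)).real E) μ :=
        fun E => integrable_layerLaw_real hXQ E
      have h1 : Integrable (fun ω => 1 -
          (layerLaw n (truncSize n (X ω)) (Q ω)).real (noEdgeAcross {u})ᶜ) μ :=
        (integrable_const _).sub (hi _)
      have h2 : Integrable (fun ω => 1 -
          (layerLaw n (truncSize n (X ω)) (Q ω)).real (noEdgeAcross {u})ᶜ -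
            (layerLaw n (truncSize n (X ω)) (Q ω)).real (noEdgeAcross {v})ᶜ) μ := h1.sub (hi _)
      rw [integral_add h2 (hi _), integral_sub h1 (hi _), integral_sub (integrable_const _) (hi _),
        hpv, hpv]
      simpa using hδuv
    -- The `4` compensates for `(1 - p) ^ 2 ≥ 1 / 4`, which holds because `p ≤ κ / n ≤ 1 / 2`.
    have hexp : 1 - p - p + U / n ≤ (1 - p) ^ 2 * Real.exp (4 * (U / n)) := by
      have h1 := Real.add_one_le_exp (4 * (U / n))
      have h2 : 0 ≤ U / n := by positivity
      have h3 : 1 / 4 ≤ (1 - p) ^ 2 := by nlinarith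
      nlinarith [mul_le_mul_of_nonneg_left h1 (sq_nonneg (1 - p)), mul_nonneg h2 (sub_nonneg.2 h3)]
    calc _ ≤ ((1 - p) ^ 2 * Real.exp (4 * (U / n))) ^ m n :=
          pow_le_pow_left₀ hnn (hval.trans hexp) _
      _ = _ := by
          rw [mul_pow, ← Real.exp_nat_mul, ← pow_mul, ← pow_mul, mul_comm 2 (m n)]
          congr 2
          ring
  have hmκ : (m n : ℝ) / n * κ ≤ Real.log n := by
    simp only [hlamdef] at hlamn
    linarith
  refine (measureReal_mono (connected_subset_iInter_compl hn)).trans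
    ((measureReal_iInter_compl_le P (by omega) _ (fun v => .of_discrete) ha0 (by positivity)
      hPa hPb).trans (add_le_add ?_ (sub_le_sub_right ?_ 1)))
  · refine inv_anti₀ (Real.exp_pos _) ?_
    calc Real.exp (lam n - 2 * κ)
        ≤ Real.exp (Real.log n + -(m n * (κ / n + 2 * (κ / n) ^ 2))) := by
          rw [Real.exp_le_exp]
          -- The second-order correction is `2 κ · (m κ / n) / n ≤ 2 κ`, since `m κ / n ≤ ln n ≤ n`.
          have h1 : (m n : ℝ) * (κ / n + 2 * (κ / n) ^ 2) =
              m n / n * κ + 2 * κ * ((m n / n * κ) / n) := by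
            field_simp
          have h2 : (m n / n * κ) / n ≤ 1 := by
            rw [div_le_one (by linarith)]
            exact hmκ.trans (Real.log_le_self (by linarith))
          rw [h1]
          simp only [hlamdef]
          nlinarith
      _ = n * Real.exp (-(m n * (κ / n + 2 * (κ / n) ^ 2))) := by
          rw [Real.exp_add, Real.exp_log (by linarith)]
      _ ≤ _ := mul_le_mul_of_nonneg_left (exp_neg_le_one_sub_pow hp0 hpκ hκn _) (by linarith)
  · rw [mul_div_cancel_left₀ _ (by positivity), Real.exp_le_exp]
    simp only [hR, inv_inv]
    -- `λ' ≥ 0` caps `m / n` at `ln n / κ`, which turns the correlation exponent into `(4 / κ) ln n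
    -- · U(1 / n) → 0`.
    have h1 : (m n : ℝ) / n ≤ Real.log n / κ := by
      rwa [le_div_iff₀ hκ]
    calc 4 * ((m n : ℝ) / n * U) ≤ 4 * (Real.log n / κ * U) :=
          mul_le_mul_of_nonneg_left (mul_le_mul_of_nonneg_right h1 hU0) (by norm_num)
      _ = _ := by ring

/-! ### The connectivity threshold -/

theorem proposition1 {Ω : Type*} [MeasurableSpace Ω] (μ : Measure Ω) [IsProbabilityMeasure μ]
    -- the generic pair `(X, Q)` and the i.i.d. sequence of its copies
    (X : Ω → ℕ) (Q : Ω → I) (Xs : ℕ → Ω → ℕ) (Qs : ℕ → Ω → I)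
    (hindep : iIndepFun (fun i ω => (Xs i ω, Qs i ω)) μ)
    (hident : ∀ i, IdentDistrib (fun ω => (Xs i ω, Qs i ω)) (fun ω => (X ω, Q ω)) μ μ)
    -- the moment conditions
    (hpos : 0 < ∫ ω, {ω | 2 ≤ X ω}.indicator (fun ω => (Q ω : ℝ)) ω ∂μ)
    (hmom : Integrable (fun ω => (X ω : ℝ) * hFun (X ω) (Q ω) * Real.log (1 + X ω)) μ)
    -- the number of communities `m = m(n)`
    (m : ℕ → ℕ) (hm : Tendsto m atTop atTop) :
    -- the threshold `λ'_{n,m} = ln n - (m / n) κ`, with `κ = E(X h(X, Q))`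
    let lam : ℕ → ℝ := fun n =>
      Real.log n - (m n : ℝ) / n * ∫ ω, (X ω : ℝ) * hFun (X ω) (Q ω) ∂μ
    -- the probability that the community affiliation graph defined by the pairs
    -- `(min {X_i, n}, Q_i)`, `i = 1, …, m(n)`, is connected
    let probConnected : ℕ → ENNReal := fun n =>
      affiliationGraphLaw n (m n)
        (μ.map fun ω (i : Fin (m n)) => (truncSize n (Xs i ω), Qs i ω)) {G | G.Connected}
    (Tendsto lam atTop atTop → Tendsto probConnected atTop (𝓝 0)) ∧
      (Tendsto lam atTop atBot → Tendsto probConnected atTop (𝓝 1)) := by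
  intro lam probConnected
  have hprob : ∀ n, IsProbabilityMeasure (affiliationGraphLaw n (m n)
      (μ.map fun ω (i : Fin (m n)) => (truncSize n (Xs i ω), Qs i ω))) := fun n => by
    have := Measure.isProbabilityMeasure_map (μ := μ)
      (f := fun ω (i : Fin (m n)) => (truncSize n (Xs i ω), Qs i ω))
      (aemeasurable_pi_lambda _ fun i =>
        (measurable_truncSize_prod n).comp_aemeasurable (hident i).aemeasurable_fst)
    infer_instance
  have hfin : ∀ n, probConnected n ≠ ⊤ := fun n => measure_ne_top _ _
  refine ⟨fun h => ?_, fun h => ?_⟩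
  · rw [← ENNReal.tendsto_toReal_iff hfin ENNReal.zero_ne_top]
    exact tendsto_probability_connected_zero hindep hident hpos hmom h
  · rw [← ENNReal.tendsto_toReal_iff hfin ENNReal.one_ne_top]
    have h1 := (tendsto_probability_connected_one hindep hident hpos hmom h).const_sub 1
    rw [sub_zero] at h1
    refine h1.congr fun n => ?_
    have := simpleGraph_discrete (Fin n)
    rw [probReal_compl_eq_one_sub (.of_discrete), sub_sub_cancel]
    rfl
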